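/- Let $k$ be a field of characteristic zero. Let $\mathrm{Ass}_n$ be the algebra of noncommutative formal power series over $k$ in $x_1,\dots,x_n$ (the degree completion of the free associative algebra), $\mathrm{Ass}_n^+$ its ideal of series without constant term, and $\mathfrak{lie}_n\subset \mathrm{Ass}_n^+$ the degree completion of the free Lie algebra on $x_1,\dots,x_n$; for $n=2$ write $x,y$ for the generators. Let $\mathrm{ch}(a,b)=\ln(e^ae^b)$ be the Campbell–Hausdorff series and $\mathrm{ad}_a(b)=ab-ba$. Let $\mathfrak{tr}_n=\mathrm{Ass}_n^+/\mathrm{span}\{ab-ba : a,b\in \mathrm{Ass}_n\}$, with natural projection $\mathrm{Tr}$. Let $\tilde\delta:\mathfrak{tr}_1\to\mathfrak{tr}_2$ be the linear map $$\tilde\delta(\mathrm{Tr} f(x))=\mathrm{Tr}\big(f(y)-f(\mathrm{ch}(x,y))+f(x)\big),\qquad f\in x\,k[[x]].$$ Let $\mathfrak{der}^{t}_n$ be the Lie algebra of tangential derivations of $\mathfrak{lie}_n$, that is, derivations $u$ with $u(x_i)=[x_i,a_i]$ for some $a_i\in\mathfrak{lie}_n$; write $u=(a_1,\dots,a_n)$,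 where each $a_i$ is normalised to have no linear term in $x_i$ (this determines the $a_i$). Such $u$ acts on $\mathrm{Ass}_n$ by continuous derivations, and hence on $\mathfrak{tr}_n$. Its divergence is $\mathrm{div}(u)=\sum_i\mathrm{Tr}(x_i\,\partial_i a_i)\in\mathfrak{tr}_n$, where the $\partial_i$ are defined by $a=a_0+\sum_i(\partial_i a)x_i$ with $a_0\in k$. Let $\mathrm{Der}^t_n=\exp(\mathfrak{der}^t_n)$ be the group integrating $\mathfrak{der}^t_n$, where $\exp(u)$ acts as the automorphism $\sum_{m\ge0}u^m/m!$, and let $j:\mathrm{Der}^t_n\to\mathfrak{tr}_n$ be the group cocycle integrating the divergence, $$j(\exp u)=\frac{e^u-1}{u}\cdot\mathrm{div}(u)=\sum_{m\ge 0}\frac{1}{(m+1)!}\,u^m\cdot\mathrm{div}(u).$$ Let $l$ be the derivation with $l(x_i)=x_i$ for all $i$, and for $g\in \mathrm{Der}^t_n$ put $\kappa(g)=l-g\,l\,g^{-1}$. An element $F\in \mathrm{Der}^t_2$ is a *solution of the generalized Kashiwara–Vergne problem* if $$F(x+y)=\mathrm{ch}(x,y)\quad\text{and}\quad j(F)\in\mathrm{im}(\tilde\delta).$$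 **Theorem.** Let $F\in\mathrm{Der}^t_2$. Then $\kappa(F)$ is a tangential derivation, given by a unique normalised pair $u=\kappa(F)=(A,B)\in\mathfrak{der}^t_2$, and $F$ is a solution of the generalized Kashiwara–Vergne problem if and only if $$x+y-\mathrm{ch}(y,x)=(1-e^{-\mathrm{ad}_x})A+(e^{\mathrm{ad}_y}-1)B$$ and $$\mathrm{div}(u)\in\mathrm{im}(\tilde\delta).$$ -/

import Mathlib

/-! Noncommutative power series, the completed free Lie algebra, tangential derivations,
the group of tangential automorphisms, and the Kashiwara-Vergne problem. -/

namespace KV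

/-- The degree completion of the free associative `k`-algebra on the generators `X i`, `i : Fin n`:
noncommutative formal power series.  A series is the family of its coefficients, indexed by
words in the letters `Fin n`. -/
def Ass (k : Type*) (n : ℕ) : Type _ := List (Fin n) → k

/-- The series with the given coefficients. -/
def Ass.of {k : Type*} {n : ℕ} (f : List (Fin n) → k) : Ass k n := f

@[simp] theorem Ass.of_apply {k : Type*} {n : ℕ} (f : List (Fin n) → k) (w : List (Fin n)) :
    Ass.of f w = f w := rfl

@[ext] theorem Ass.ext {k : Type*} {n : ℕ} {f g : Ass k n} (h : ∀ w, f w = g w) : f = g :=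
  funext h

noncomputable section

variable {k : Type*} [Field k] {n m : ℕ}

instance : AddCommGroup (Ass k n) := inferInstanceAs (AddCommGroup (List (Fin n) → k))

instance : Module k (Ass k n) := inferInstanceAs (Module k (List (Fin n) → k))

@[simp] theorem Ass.zero_apply (w : List (Fin n)) : (0 : Ass k n) w = 0 := rfl

@[simp] theorem Ass.add_apply (f g : Ass k n) (w : List (Fin n)) : (f + g) w = f w + g w := rfl

@[simp] theorem Ass.neg_apply (f : Ass k n) (w : List (Fin n)) : (-f) w = -f w := rfl

@[simp] theorem Ass.sub_apply (f g : Ass k n) (w : List (Fin n)) : (f - g) w = f w - g w := rfl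

@[simp] theorem Ass.smul_apply (c : k) (f : Ass k n) (w : List (Fin n)) :
    (c • f) w = c * f w := rfl

/-- Evaluation of the coefficient of the word `w`. -/
def coeff (w : List (Fin n)) : Ass k n →ₗ[k] k where
  toFun f := f w
  map_add' _ _ := rfl
  map_smul' _ _ := rfl

@[simp] theorem coeff_apply (w : List (Fin n)) (f : Ass k n) : coeff w f = f w := rfl

@[simp] theorem Ass.sum_apply {ι : Type*} (s : Finset ι) (f : ι → Ass k n) (w : List (Fin n)) :
    (∑ i ∈ s, f i) w = ∑ i ∈ s, f i w := map_sum (coeff w) f s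

/-- The concatenation product, `(f * g)(w) = ∑_{w = uv} f(u) g(v)`. -/
instance : Mul (Ass k n) :=
  ⟨fun f g => Ass.of fun w => ∑ i ∈ Finset.range (w.length + 1), f (w.take i) * g (w.drop i)⟩

theorem Ass.mul_apply (f g : Ass k n) (w : List (Fin n)) :
    (f * g) w = ∑ i ∈ Finset.range (w.length + 1), f (w.take i) * g (w.drop i) := rfl

instance : One (Ass k n) := ⟨Ass.of fun w => if w = [] then 1 else 0⟩

theorem Ass.one_apply (w : List (Fin n)) : (1 : Ass k n) w = if w = [] then 1 else 0 := rfl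

theorem Ass.mul_assoc' (f g h : Ass k n) : f * g * h = f * (g * h) := by
  ext w
  simp only [Ass.mul_apply, Finset.sum_mul, Finset.mul_sum]
  rw [Finset.sum_sigma', Finset.sum_sigma']
  refine Finset.sum_bij' (fun p _ => ⟨p.2, p.1 - p.2⟩) (fun p _ => ⟨p.1 + p.2, p.1⟩)
    ?_ ?_ ?_ ?_ ?_
  · rintro ⟨a, b⟩ h
    simp only [Finset.mem_sigma, Finset.mem_range, List.length_take, List.length_drop] at h ⊢
    omega
  · rintro ⟨a, b⟩ h
    simp only [Finset.mem_sigma, Finset.mem_range, List.length_take, List.length_drop] at h ⊢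
    omega
  · rintro ⟨a, b⟩ h
    simp only [Finset.mem_sigma, Finset.mem_range, List.length_take] at h
    have : b + (a - b) = a := by omega
    simp [this]
  · rintro ⟨a, b⟩ h
    simp
  · rintro ⟨a, b⟩ h
    simp only [Finset.mem_sigma, Finset.mem_range, List.length_take] at h
    have h1 : min b a = b := by omega
    have h2 : b + (a - b) = a := by omega
    simp only [List.take_take, List.drop_drop, List.drop_take, h1, h2, _root_.mul_assoc]

instance : Ring (Ass k n) where
  __ := (inferInstance : AddCommGroup (Ass k n))
  mul_assoc := Ass.mul_assoc'
  one_mul f := by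
    ext w
    rw [Ass.mul_apply, Finset.sum_eq_single 0]
    · simp [Ass.one_apply]
    · intro b hb hb0
      rw [Finset.mem_range] at hb
      have : w.take b ≠ [] := by
        intro h
        have := congrArg List.length h
        simp only [List.length_take, List.length_nil] at this
        omega
      simp [Ass.one_apply, this]
    · simp
  mul_one f := by
    ext w
    rw [Ass.mul_apply, Finset.sum_eq_single w.length]
    · simp [Ass.one_apply]
    · intro b hb hb0
      rw [Finset.mem_range] at hb
      have : w.drop b ≠ [] := by
        intro h
        have := congrArg List.length h
        simp only [List.length_drop, List.length_nil] at this
        omega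
      simp [Ass.one_apply, this]
    · simp
  zero_mul f := by ext w; simp [Ass.mul_apply]
  mul_zero f := by ext w; simp [Ass.mul_apply]
  left_distrib f g h := by ext w; simp [Ass.mul_apply, mul_add, Finset.sum_add_distrib]
  right_distrib f g h := by ext w; simp [Ass.mul_apply, add_mul, Finset.sum_add_distrib]

instance : Algebra k (Ass k n) :=
  Algebra.ofModule
    (fun c f g => by ext w; simp [Ass.mul_apply, Finset.mul_sum, mul_assoc])
    (fun c f g => by ext w; simp [Ass.mul_apply, Finset.mul_sum, mul_left_comm])

/-- The generator `x_i`. -/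
def X (i : Fin n) : Ass k n := Ass.of fun w => if w = [i] then 1 else 0

/-- The sum `∑_{d ≥ 0} c d` of a sequence of series in which all words of `c d` have length at
least `d`: on a word of length `N` only the terms with `d ≤ N` contribute.  It is used
below only for such sequences. -/
def seriesSum : (ℕ → Ass k n) →ₗ[k] Ass k n where
  toFun c := Ass.of fun w => ∑ d ∈ Finset.range (w.length + 1), c d w
  map_add' c e := by ext w; simp [Finset.sum_add_distrib]
  map_smul' r c := by ext w; simp [Finset.mul_sum]

/-- `e^a = ∑ a^d / d!`, for `a` without constant term. -/
def expA (a : Ass k n) : Ass k n := seriesSum fun d => (d.factorial : k)⁻¹ • a ^ d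

/-- `ln g = ∑_{d ≥ 0} (-1)^d (g - 1)^(d+1) / (d+1)`, for `g` with constant term `1`. -/
def logA (g : Ass k n) : Ass k n :=
  seriesSum fun d => ((-1 : k) ^ d / ((d : k) + 1)) • (g - 1) ^ (d + 1)

/-- The Campbell-Hausdorff series `ch(a, b) = ln (e^a e^b)`. -/
def ch (a b : Ass k n) : Ass k n := logA (expA a * expA b)

/-- `e^T = ∑ T^d / d!` for a linear operator `T` on series that raises the degree. -/
def expEnd (T : Module.End k (Ass k n)) : Module.End k (Ass k n) :=
  seriesSum ∘ₗ LinearMap.pi fun d => (d.factorial : k)⁻¹ • T ^ d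

/-- `(e^T - 1) / T = ∑ T^d / (d+1)!` for a linear operator `T` on series that raises the
degree. -/
def expSubOneDiv (T : Module.End k (Ass k n)) : Module.End k (Ass k n) :=
  seriesSum ∘ₗ LinearMap.pi fun d => ((d + 1).factorial : k)⁻¹ • T ^ d

/-- `ad_a b = ab - ba`. -/
def ad (a : Ass k n) : Module.End k (Ass k n) := LinearMap.mulLeft k a - LinearMap.mulRight k a

/-- Substitution `f(a_1, …, a_m)` of series `a_i` without constant term into a series `f`. -/
def subst (a : Fin m → Ass k n) : Ass k m →ₗ[k] Ass k n :=
  seriesSum ∘ₗ LinearMap.pi fun d =>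
    ∑ v : Fin d → Fin m,
      (coeff (List.ofFn v)).smulRight ((List.ofFn v).map a).prod

/-- The value on a word of the derivation that sends `x_i` to `b i`. -/
def wordDer (b : Fin n → Ass k n) : List (Fin n) → Ass k n
  | [] => 0
  | i :: w => b i * (w.map X).prod + X i * wordDer b w

/-- The (continuous) derivation of `Ass k n` with `x_i ↦ b i`, for `b i` without constant term. -/
def derivation (b : Fin n → Ass k n) : Module.End k (Ass k n) :=
  seriesSum ∘ₗ LinearMap.pi fun d =>
    ∑ v : Fin d → Fin n, (coeff (List.ofFn v)).smulRight (wordDer b (List.ofFn v))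

/-- The derivation `l` with `l(x_i) = x_i` for all `i`. -/
def euler : Module.End k (Ass k n) := derivation X

/-- The homogeneous component of degree `d`. -/
def homog (d : ℕ) : Ass k n →ₗ[k] Ass k n where
  toFun f := Ass.of fun w => if w.length = d then f w else 0
  map_add' f g := by ext w; by_cases h : w.length = d <;> simp [h]
  map_smul' c f := by ext w; by_cases h : w.length = d <;> simp [h]

section
attribute [local instance 100] LieRing.ofAssociativeRing

/-- Lie polynomials: the Lie subalgebra of the free associative algebra generated by the
`x_i`, which is the free Lie algebra on these generators. -/
def liePoly (k : Type*) [Field k] (n : ℕ) : LieSubalgebra k (Ass k n) :=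
  LieSubalgebra.lieSpan k (Ass k n) (Set.range X)

/-- `lie_n`, the degree completion of the free Lie algebra: series all of whose homogeneous
components are Lie polynomials. -/
def lie (k : Type*) [Field k] (n : ℕ) : Submodule k (Ass k n) :=
  ⨅ d : ℕ, (liePoly k n).toSubmodule.comap (homog d)

end

/-- Tangential derivations of `lie_n`, as tuples `u = (a_1, …, a_n)` of elements of `lie_n`,
normalised so that `a_i` has no linear term in `x_i`.  The derivation is `tangential u`. -/
def dert (k : Type*) [Field k] (n : ℕ) : Submodule k (Fin n → Ass k n) :=
  ⨅ i : Fin n, (lie k n ⊓ LinearMap.ker (coeff [i])).comap (LinearMap.proj i)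

/-- The derivation `x_i ↦ [x_i, a_i]` defined by `u = (a_1, …, a_n)`. -/
def tangential (u : dert k n) : Module.End k (Ass k n) :=
  derivation fun i => ad (X i) (u.1 i)

/-- The group integrating `dert_n`.  As a set it is a copy of `dert_n`, and `Dert.exp` and
`Dert.log` are the two identifications. -/
structure Dert (k : Type*) [Field k] (n : ℕ) where
  /-- the exponential map -/
  exp ::
  /-- the logarithm -/
  log : dert k n

/-- The inverse `exp(u)⁻¹ = exp(-u)`. -/
instance : Inv (Dert k n) := ⟨fun g => Dert.exp (-g.log)⟩

/-- The automorphism `exp(u) = ∑ u^d / d!` of the completed free algebra; it restricts to an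
automorphism of `lie_n`. -/
def Dert.act (g : Dert k n) : Module.End k (Ass k n) := expEnd (tangential g.log)

/-- `κ(g) = l - g l g⁻¹`, as an operator. -/
def kappa (g : Dert k n) : Module.End k (Ass k n) := euler - g.act * euler * g⁻¹.act

/-- Series without constant term. -/
def AssPlus (k : Type*) [Field k] (n : ℕ) : Submodule k (Ass k n) := LinearMap.ker (coeff [])

/-- The span of the commutators `ab - ba`, inside the series without constant term. -/
def commutators (k : Type*) [Field k] (n : ℕ) : Submodule k (AssPlus k n) :=
  (Submodule.span k {c : Ass k n | ∃ a b, c = a * b - b * a}).comap (AssPlus k n).subtype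

/-- `tr_n`. -/
abbrev tr (k : Type*) [Field k] (n : ℕ) : Type _ := AssPlus k n ⧸ commutators k n

/-- The projection that removes the constant term. -/
def dropConst : Ass k n →ₗ[k] AssPlus k n :=
  (LinearMap.id - (coeff []).smulRight (1 : Ass k n)).codRestrict (AssPlus k n)
    (fun f => by simp [AssPlus, Ass.one_apply])

/-- The natural projection `Tr`. -/
def Tr : Ass k n →ₗ[k] tr k n := (commutators k n).mkQ ∘ₗ dropConst

/-- `∂_i a`, where `a = a_0 + ∑ (∂_i a) x_i`. -/
def partialDer (i : Fin n) : Ass k n →ₗ[k] Ass k n where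
  toFun a := Ass.of fun w => a (w ++ [i])
  map_add' _ _ := rfl
  map_smul' _ _ := rfl

/-- The representative `∑ x_i (∂_i a_i)` of the divergence of `u = (a_1, …, a_n)`. -/
def divRep (u : dert k n) : Ass k n := ∑ i, X i * partialDer i (u.1 i)

/-- The divergence `div(u) = ∑ Tr(x_i (∂_i a_i))`. -/
def div (u : dert k n) : tr k n := Tr (divRep u)

/-- The group cocycle integrating the divergence,
`j(exp u) = ((e^u - 1)/u) · div(u) = ∑ u^d · div(u) / (d+1)!`.
The action of `u` on `tr_n` is induced by its action on series, so the sum may be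
computed on a representative. -/
def j (g : Dert k n) : tr k n := Tr (expSubOneDiv (tangential g.log) (divRep g.log))

theorem Ass.mul_comm_one (f g : Ass k 1) : f * g = g * f := by
  have key : ∀ v w : List (Fin 1), v.length = w.length → v = w := by
    intro v w h
    exact List.ext_getElem h fun i _ _ => Subsingleton.elim _ _
  ext w
  rw [Ass.mul_apply, Ass.mul_apply, ← Finset.sum_range_reflect]
  refine Finset.sum_congr rfl fun i hi => ?_
  rw [Finset.mem_range] at hi
  rw [mul_comm, key (w.drop (w.length + 1 - 1 - i)) (w.take i),
    key (w.take (w.length + 1 - 1 - i)) (w.drop i)]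
  · simp only [List.length_take, List.length_drop]; omega
  · simp only [List.length_take, List.length_drop]; omega

theorem commutators_one : commutators k 1 = ⊥ := by
  rw [commutators, show {c : Ass k 1 | ∃ a b, c = a * b - b * a} = {0} by
    ext c
    change (∃ a b, c = a * b - b * a) ↔ c = 0
    constructor
    · rintro ⟨a, b, rfl⟩
      rw [Ass.mul_comm_one, sub_self]
    · rintro rfl
      exact ⟨0, 0, by simp⟩]
  simp

/-- The differential on `tr_1`: `f(x) ↦ f(y) - f(ch(x, y)) + f(x)`. -/
def deltaTilde (k : Type*) [Field k] : tr k 1 →ₗ[k] tr k 2 :=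
  (commutators k 1).liftQ
    (Tr ∘ₗ (subst (fun _ => X 1) - subst (fun _ => ch (X 0) (X 1)) + subst (fun _ => X 0)) ∘ₗ
      (AssPlus k 1).subtype)
    (by rw [commutators_one]; exact bot_le)

/-- `F` solves the generalized Kashiwara-Vergne problem: `F(x + y) = ch(x, y)` and `j(F)` lies
in the image of the differential. -/
def IsGeneralizedKVSolution (F : Dert k 2) : Prop :=
  F.act (X 0 + X 1) = ch (X 0) (X 1) ∧ j F ∈ LinearMap.range (deltaTilde k)

/-- The original Kashiwara-Vergne equation for a pair `(A, B)`. -/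
def OriginalKVEquation (A B : Ass k 2) : Prop :=
  X 0 + X 1 - ch (X 1) (X 0) =
    (1 - expEnd (-ad (X 0))) A + (expEnd (ad (X 1)) - 1) B

end

end KV

namespace KV

noncomputable section

variable {k : Type*} [Field k] {n m : ℕ}

/-! Write F = e^W, with W the tangential derivation of a tuple w. Conjugation by F is e^{ad W}, so
κ(F) = l - e^{ad W} l = ∑_{d≥0} ad_W^d([l, W])/(d+1)!. Tangential derivations are stable under
brackets with each other and with l, and normalisation survives; this gives the tuple `kappaTuple`.
Uniqueness holds because a Lie series commuting with x_i and without linear term in x_i vanishes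
(`eq_zero_of_ad_X_eq_zero`).

First equation. Since F⁻¹ is unipotent, F⁻¹(ch(x,y)) agrees with x + y in degree one, so F(x+y) =
ch(x,y) says exactly that l fixes F⁻¹(ch(x,y)), that is, (u - l)(ch(x,y)) = -ch(x,y) for u = κ(F)
(`act_add_eq_ch_iff`). For the derivation D = u - l this is a condition on D(e^x e^y). Expanding it
by Leibniz and multiplying by e^{-x} on the left and e^{-y} on the right yields the original
Kashiwara-Vergne equation (`originalKVEquation_iff`).

Second equation. Divergence is a 1-cocycle (`cyc_divTuple_bracket`). Applied to the iterated
brackets in κ(F), it gives div κ(F) = F l F⁻¹ · j(F) in tr_2 (`cyc_divTuple_kappaTuple`,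
`expEnd_neg_expSubOneDiv`). If F(x+y) = ch(x,y), then F⁻¹ carries Tr(f(y) - f(ch(x,y)) + f(x)) to
Tr(f(y) - f(x+y) + f(x)), because tangential automorphisms fix Tr f(x) and Tr f(y). There l acts
through f ↦ l(f). So F l F⁻¹ maps the image of the differential onto itself, and it is injective on
tr_2, l being invertible in positive degree; hence j(F) and div κ(F) lie in that image
simultaneously (`j_mem_range_iff`).

Classes in tr_n are handled through cyclic sums of coefficients: `Tr_eq_iff` identifies equality in
tr_n with equality under `cyc`. Convergence is controlled by the degree filtration `Fil` and by maps
that do not lower it. -/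

/-! ### The degree filtration and maps that raise the degree -/

/-- The series supported on words of length at least `N`. -/
def Fil (k : Type*) [Field k] (n N : ℕ) : Submodule k (Ass k n) where
  carrier := {f | ∀ w : List (Fin n), w.length < N → f w = 0}
  add_mem' hf hg w hw := by simp [hf w hw, hg w hw]
  zero_mem' w _ := rfl
  smul_mem' c f hf w hw := by simp [hf w hw]

theorem Fil_anti {N M : ℕ} (h : N ≤ M) : Fil k n M ≤ Fil k n N :=
  fun _ hf w hw => hf w (hw.trans_le h)

theorem mem_Fil_zero (f : Ass k n) : f ∈ Fil k n 0 := fun _ hw => absurd hw (Nat.not_lt_zero _)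

theorem mem_Fil_one {f : Ass k n} : f ∈ Fil k n 1 ↔ f [] = 0 := by
  constructor
  · intro h
    exact h [] (by simp)
  · intro h w hw
    have : w = [] := List.length_eq_zero_iff.mp (by omega)
    rw [this, h]

theorem Fil_mul {N M : ℕ} {f g : Ass k n} (hf : f ∈ Fil k n N) (hg : g ∈ Fil k n M) :
    f * g ∈ Fil k n (N + M) := by
  intro w hw
  rw [Ass.mul_apply]
  refine Finset.sum_eq_zero fun i hi => ?_
  rw [Finset.mem_range] at hi
  by_cases h : i < N
  · rw [hf _ (by rw [List.length_take]; omega), zero_mul]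
  · rw [hg (w.drop i) (by rw [List.length_drop]; omega), mul_zero]

theorem Fil_pow {a : Ass k n} (ha : a ∈ Fil k n 1) (d : ℕ) : a ^ d ∈ Fil k n d := by
  induction d with
  | zero => exact mem_Fil_zero _
  | succ d ih => rw [pow_succ]; exact Fil_mul ih ha

theorem eq_zero_of_mem_Fil {f : Ass k n} (h : ∀ N, f ∈ Fil k n N) : f = 0 := by
  ext w
  exact h (w.length + 1) w (Nat.lt_succ_self _)

/-- Linear maps that raise the degree by at least `r`. -/
def Raises (r : ℕ) (T : Ass k m →ₗ[k] Ass k n) : Prop :=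
  ∀ N, ∀ f ∈ Fil k m N, T f ∈ Fil k n (N + r)

theorem Raises.mono {r s : ℕ} (h : r ≤ s) {T : Ass k m →ₗ[k] Ass k n} (hT : Raises s T) :
    Raises r T := fun N f hf => Fil_anti (by omega) (hT N f hf)

theorem Raises.zero' {r : ℕ} {T : Ass k m →ₗ[k] Ass k n} (hT : Raises r T) : Raises 0 T :=
  hT.mono (Nat.zero_le _)

theorem Raises.add {r : ℕ} {T S : Ass k m →ₗ[k] Ass k n} (hT : Raises r T) (hS : Raises r S) :
    Raises r (T + S) := fun N f hf => add_mem (hT N f hf) (hS N f hf)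

theorem Raises.sub {r : ℕ} {T S : Ass k m →ₗ[k] Ass k n} (hT : Raises r T) (hS : Raises r S) :
    Raises r (T - S) := fun N f hf => sub_mem (hT N f hf) (hS N f hf)

theorem Raises.neg {r : ℕ} {T : Ass k m →ₗ[k] Ass k n} (hT : Raises r T) :
    Raises r (-T) := fun N f hf => neg_mem (hT N f hf)

theorem Raises.smul {r : ℕ} {T : Ass k m →ₗ[k] Ass k n} (hT : Raises r T) (c : k) :
    Raises r (c • T) := fun N f hf => Submodule.smul_mem _ c (hT N f hf)

theorem Raises.comp {p r s : ℕ} {T : Ass k m →ₗ[k] Ass k n} {S : Ass k p →ₗ[k] Ass k m}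
    (hT : Raises r T) (hS : Raises s S) : Raises (s + r) (T ∘ₗ S) :=
  fun N f hf => by rw [← add_assoc]; exact hT _ _ (hS N f hf)

theorem Raises.comp_zero {p : ℕ} {T : Ass k m →ₗ[k] Ass k n} {S : Ass k p →ₗ[k] Ass k m}
    (hT : Raises 0 T) (hS : Raises 0 S) : Raises 0 (T ∘ₗ S) := hT.comp hS

theorem Raises.mul {r s : ℕ} {T S : Module.End k (Ass k n)}
    (hT : Raises r T) (hS : Raises s S) : Raises (s + r) (T * S) := hT.comp hS

theorem raises_one : Raises 0 (1 : Module.End k (Ass k n)) := fun _ _ hf => hf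

theorem Raises.pow {T : Module.End k (Ass k n)} (hT : Raises 1 T) (d : ℕ) :
    Raises d (T ^ d) := by
  induction d with
  | zero => exact raises_one
  | succ d ih => rw [pow_succ, add_comm]; exact ih.mul hT

theorem raises_mulLeft {r : ℕ} {a : Ass k n} (ha : a ∈ Fil k n r) :
    Raises r (LinearMap.mulLeft k a) := fun N f hf => by
  rw [add_comm]; exact Fil_mul ha hf

theorem raises_mulRight {r : ℕ} {a : Ass k n} (ha : a ∈ Fil k n r) :
    Raises r (LinearMap.mulRight k a) := fun _ _ hf => Fil_mul hf ha

theorem ad_apply (a f : Ass k n) : ad a f = a * f - f * a := rfl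

theorem raises_ad {r : ℕ} {a : Ass k n} (ha : a ∈ Fil k n r) : Raises r (ad a) :=
  (raises_mulLeft ha).sub (raises_mulRight ha)

/-! ### Convergent series -/

theorem seriesSum_apply (c : ℕ → Ass k n) (w : List (Fin n)) :
    seriesSum c w = ∑ d ∈ Finset.range (w.length + 1), c d w := rfl

theorem seriesSum_mem_Fil {N : ℕ} {c : ℕ → Ass k n} (hc : ∀ d, c d ∈ Fil k n N) :
    seriesSum c ∈ Fil k n N := fun w hw => by
  rw [seriesSum_apply]
  exact Finset.sum_eq_zero fun d _ => hc d w hw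

theorem seriesSum_sub_mem_Fil {c : ℕ → Ass k n} (hc : ∀ d, c d ∈ Fil k n d) (N : ℕ) :
    seriesSum c - ∑ d ∈ Finset.range N, c d ∈ Fil k n N := fun w hw => by
  rw [Ass.sub_apply, seriesSum_apply, Ass.sum_apply, sub_eq_zero]
  refine Finset.sum_subset (Finset.range_mono hw) fun d _ hd => hc d w ?_
  rw [Finset.mem_range] at hd
  omega

/-- A map that does not lower degree is continuous: a coefficient of the image depends only on a
finite truncation of the argument. -/
theorem map_seriesSum {T : Ass k m →ₗ[k] Ass k n} (hT : Raises 0 T) {c : ℕ → Ass k m}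
    (hc : ∀ d, c d ∈ Fil k m d) : T (seriesSum c) = seriesSum fun d => T (c d) := by
  ext w
  have h := hT _ _ (seriesSum_sub_mem_Fil hc (w.length + 1)) w (Nat.lt_succ_self _)
  rw [map_sub, map_sum, Ass.sub_apply, sub_eq_zero, Ass.sum_apply] at h
  rw [h, seriesSum_apply]

theorem seriesSum_succ {c : ℕ → Ass k n} (hc : ∀ d, c d ∈ Fil k n d) :
    seriesSum c = c 0 + seriesSum fun d => c (d + 1) := by
  ext w
  -- On a word of length N the shifted series also includes the term of index N + 1, which vanishes
  -- there for degree reasons.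
  rw [Ass.add_apply, seriesSum_apply, seriesSum_apply, Finset.sum_range_succ',
    Finset.sum_range_succ _ w.length, hc (w.length + 1) w (Nat.lt_succ_self _)]
  ring

theorem seriesSum_seriesSum {c : ℕ → ℕ → Ass k n} (hc : ∀ p q, c p q ∈ Fil k n (p + q)) :
    (seriesSum fun p => seriesSum (c p)) =
      seriesSum fun d => ∑ x ∈ Finset.HasAntidiagonal.antidiagonal d, c x.1 x.2 := by
  ext w
  simp only [seriesSum_apply, Ass.sum_apply]
  rw [← Finset.sum_product', Finset.sum_sigma']
  symm
  -- The square p, q ≤ N is compared with the triangle p + q ≤ N; the terms in between vanish on a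
  -- word of length N.
  refine Finset.sum_bij_ne_zero (fun x _ _ => x.2) ?_ ?_ ?_ ?_
  · rintro ⟨d, p, q⟩ h _
    simp only [Finset.mem_sigma, Finset.mem_range, Finset.HasAntidiagonal.mem_antidiagonal] at h
    simp only [Finset.mem_product, Finset.mem_range]
    omega
  · rintro ⟨d, p, q⟩ h _ ⟨d', p', q'⟩ h' _ heq
    simp only [Finset.mem_sigma, Finset.mem_range, Finset.HasAntidiagonal.mem_antidiagonal] at h h'
    simp only [Prod.mk.injEq] at heq
    obtain ⟨rfl, rfl⟩ := heq
    obtain rfl : d = d' := by omega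
    rfl
  · rintro ⟨p, q⟩ _ hne
    refine ⟨⟨p + q, p, q⟩, ?_, hne, rfl⟩
    simp only [Finset.mem_sigma, Finset.mem_range, Finset.HasAntidiagonal.mem_antidiagonal, and_true]
    by_contra hcon
    exact hne (hc p q w (by omega))
  · intros
    rfl

theorem seriesSum_eq_zero_term {c : ℕ → Ass k n} (hc : ∀ d, d ≠ 0 → c d = 0) :
    seriesSum c = c 0 := by
  ext w
  rw [seriesSum_apply, Finset.sum_eq_single 0]
  · intro d _ hd
    rw [hc d hd]
    rfl
  · simp

/-! ### Words and extension by continuity -/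

theorem X_mul_nil (i : Fin n) (f : Ass k n) : (X i * f : Ass k n) [] = 0 := by
  simp [Ass.mul_apply, X]

theorem X_mem_Fil (i : Fin n) : (X i : Ass k n) ∈ Fil k n 1 := mem_Fil_one.2 (by simp [X])

theorem X_mul_cons (i j : Fin n) (f : Ass k n) (w : List (Fin n)) :
    (X i * f : Ass k n) (j :: w) = if j = i then f w else 0 := by
  rw [Ass.mul_apply, Finset.sum_eq_single 1]
  · simp [X]
  · intro b hb hb1
    rw [Finset.mem_range, List.length_cons] at hb
    have : (j :: w).take b ≠ [i] := fun h => by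
      have := congrArg List.length h
      simp only [List.length_take, List.length_cons, List.length_nil] at this
      omega
    simp [X, this]
  · simp

theorem mul_X_nil (i : Fin n) (f : Ass k n) : (f * X i : Ass k n) [] = 0 := by
  simp [Ass.mul_apply, X]

theorem mul_X_append (i j : Fin n) (f : Ass k n) (w : List (Fin n)) :
    (f * X i : Ass k n) (w ++ [j]) = if j = i then f w else 0 := by
  rw [Ass.mul_apply, Finset.sum_eq_single w.length]
  · simp [X]
  · intro b hb hb1
    rw [Finset.mem_range, List.length_append, List.length_singleton] at hb
    have : (w ++ [j]).drop b ≠ [i] := fun h => by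
      have := congrArg List.length h
      simp only [List.length_drop, List.length_append, List.length_cons, List.length_nil] at this
      omega
    simp [X, this]
  · simp

/-- The word `w` as a monomial. -/
def monom (k : Type*) [Field k] {n : ℕ} (w : List (Fin n)) : Ass k n := (w.map X).prod

theorem monom_nil : monom k ([] : List (Fin n)) = 1 := rfl

theorem monom_cons (i : Fin n) (w : List (Fin n)) : monom k (i :: w) = X i * monom k w := rfl

theorem monom_append (v w : List (Fin n)) : (monom k (v ++ w) : Ass k n) = monom k v * monom k w := by
  simp [monom]

theorem monom_apply (v w : List (Fin n)) : monom k v w = if w = v then 1 else 0 := by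
  induction v generalizing w with
  | nil => rfl
  | cons i v ih =>
    rw [monom_cons]
    cases w with
    | nil => rw [X_mul_nil]; simp
    | cons j w =>
      rw [X_mul_cons, ih]
      by_cases h : j = i <;> simp [h]

theorem prod_mem_Fil {a : Fin m → Ass k n} (ha : ∀ i, a i ∈ Fil k n 1) (w : List (Fin m)) :
    (w.map a).prod ∈ Fil k n w.length := by
  induction w with
  | nil => exact mem_Fil_zero _
  | cons i w ih =>
    rw [List.map_cons, List.prod_cons, List.length_cons, add_comm]
    exact Fil_mul (ha i) ih

/-- The continuous linear map with prescribed values on words. -/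
def wordExt (φ : List (Fin m) → Ass k n) : Ass k m →ₗ[k] Ass k n :=
  seriesSum ∘ₗ LinearMap.pi fun d =>
    ∑ v : Fin d → Fin m, (coeff (List.ofFn v)).smulRight (φ (List.ofFn v))

theorem wordExt_apply (φ : List (Fin m) → Ass k n) (f : Ass k m) :
    wordExt φ f = seriesSum fun d => ∑ v : Fin d → Fin m, f (List.ofFn v) • φ (List.ofFn v) := by
  ext w
  simp [wordExt, seriesSum_apply]

theorem wordExt_term_mem {φ : List (Fin m) → Ass k n} (hφ : ∀ w, φ w ∈ Fil k n w.length)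
    (f : Ass k m) (d : ℕ) :
    ∑ v : Fin d → Fin m, f (List.ofFn v) • φ (List.ofFn v) ∈ Fil k n d := by
  refine sum_mem fun v _ => Submodule.smul_mem _ _ ?_
  simpa using hφ (List.ofFn v)

theorem raises_wordExt {r : ℕ} {φ : List (Fin m) → Ass k n}
    (hφ : ∀ w, φ w ∈ Fil k n (w.length + r)) : Raises r (wordExt φ) := fun N f hf => by
  rw [wordExt_apply]
  refine seriesSum_mem_Fil fun d => sum_mem fun v _ => ?_
  by_cases h : d < N
  · rw [hf _ (by simpa using h), zero_smul]
    exact zero_mem _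
  · refine Submodule.smul_mem _ _ (Fil_anti ?_ (hφ _))
    rw [List.length_ofFn]
    omega

theorem wordExt_monom {φ : List (Fin m) → Ass k n} (hφ : ∀ w, φ w ∈ Fil k n w.length)
    (v : List (Fin m)) : wordExt φ (monom k v) = φ v := by
  have key : ∀ d, ∑ u : Fin d → Fin m, monom k v (List.ofFn u) • φ (List.ofFn u) =
      if d = v.length then φ v else 0 := by
    intro d
    split_ifs with h
    · subst h
      rw [Finset.sum_eq_single v.get]
      · simp [monom_apply]
      · intro u _ hu
        rw [monom_apply, if_neg, zero_smul]
        intro hcon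
        apply hu
        apply List.ofFn_injective
        rw [hcon, List.ofFn_get]
      · simp
    · refine Finset.sum_eq_zero fun u _ => ?_
      rw [monom_apply, if_neg, zero_smul]
      intro hcon
      apply h
      rw [← hcon, List.length_ofFn]
  rw [wordExt_apply]
  ext w
  simp only [seriesSum_apply, key]
  by_cases hw : v.length < w.length + 1
  · rw [Finset.sum_eq_single v.length]
    · simp
    · intro d _ hd
      simp [hd]
    · simp [hw]
  -- The word v is longer than w, so its term is cut off by the truncated sum; the degree bound on φ
  -- makes this harmless.
  · rw [hφ v w (by omega)]
    refine Finset.sum_eq_zero fun d hd => ?_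
    rw [Finset.mem_range] at hd
    rw [if_neg (by omega)]
    rfl

theorem wordExt_monom_self (f : Ass k n) : wordExt (monom k) f = f := by
  ext w
  rw [wordExt_apply, seriesSum_apply, Finset.sum_eq_single w.length]
  · rw [Ass.sum_apply, Finset.sum_eq_single w.get]
    · simp [monom_apply]
    · intro u _ hu
      rw [Ass.smul_apply, monom_apply, if_neg, mul_zero]
      intro hcon
      apply hu
      apply List.ofFn_injective
      rw [← hcon, List.ofFn_get]
    · simp
  · intro d _ hd
    rw [Ass.sum_apply]
    refine Finset.sum_eq_zero fun u _ => ?_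
    rw [Ass.smul_apply, monom_apply, if_neg, mul_zero]
    intro hcon
    apply hd
    rw [hcon, List.length_ofFn]
  · simp

theorem monom_mem_Fil (w : List (Fin n)) : monom k w ∈ Fil k n w.length :=
  prod_mem_Fil X_mem_Fil w

/-- Continuous linear maps are determined by their values on words. -/
theorem raises_ext {T S : Ass k m →ₗ[k] Ass k n} (hT : Raises 0 T) (hS : Raises 0 S)
    (h : ∀ w, T (monom k w) = S (monom k w)) (f : Ass k m) : T f = S f := by
  rw [← wordExt_monom_self f, wordExt_apply, map_seriesSum hT (wordExt_term_mem monom_mem_Fil f),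
    map_seriesSum hS (wordExt_term_mem monom_mem_Fil f)]
  simp only [map_sum, map_smul, h]

/-! ### Continuous derivations -/

/-- Continuous derivations of the algebra of series. -/
structure IsDer (D : Module.End k (Ass k n)) : Prop where
  raises : Raises 0 D
  leibniz : ∀ f g, D (f * g) = D f * g + f * D g

theorem IsDer.map_one {D : Module.End k (Ass k n)} (hD : IsDer D) : D 1 = 0 := by
  have h := hD.leibniz 1 1
  simpa using h

theorem IsDer.add {D E : Module.End k (Ass k n)} (hD : IsDer D) (hE : IsDer E) :
    IsDer (D + E) where
  raises := hD.raises.add hE.raises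
  leibniz f g := by
    simp only [LinearMap.add_apply, hD.leibniz, hE.leibniz]
    noncomm_ring

theorem IsDer.sub {D E : Module.End k (Ass k n)} (hD : IsDer D) (hE : IsDer E) :
    IsDer (D - E) where
  raises := hD.raises.sub hE.raises
  leibniz f g := by
    simp only [LinearMap.sub_apply, hD.leibniz, hE.leibniz]
    noncomm_ring

theorem IsDer.smul {D : Module.End k (Ass k n)} (hD : IsDer D) (c : k) : IsDer (c • D) where
  raises := hD.raises.smul c
  leibniz f g := by
    simp only [LinearMap.smul_apply, hD.leibniz, smul_add, smul_mul_assoc, mul_smul_comm]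

theorem IsDer.commutator {D E : Module.End k (Ass k n)} (hD : IsDer D) (hE : IsDer E) :
    IsDer (D * E - E * D) where
  raises := (hD.raises.mul hE.raises).sub (hE.raises.mul hD.raises)
  leibniz f g := by
    simp only [LinearMap.sub_apply, Module.End.mul_apply, hD.leibniz, hE.leibniz, map_add]
    noncomm_ring

theorem isDer_ad (a : Ass k n) : IsDer (ad a) where
  raises := raises_ad (mem_Fil_zero a)
  leibniz f g := by
    simp only [ad_apply]
    noncomm_ring

theorem IsDer.ext {D E : Module.End k (Ass k n)} (hD : IsDer D) (hE : IsDer E)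
    (h : ∀ i, D (X i) = E (X i)) : D = E := by
  refine LinearMap.ext (raises_ext hD.raises hE.raises fun w => ?_)
  induction w with
  | nil => rw [monom_nil, hD.map_one, hE.map_one]
  | cons i w ih => rw [monom_cons, hD.leibniz, hE.leibniz, ih, h]

theorem wordDer_mem_Fil {r : ℕ} {b : Fin n → Ass k n} (hb : ∀ i, b i ∈ Fil k n (r + 1))
    (w : List (Fin n)) : wordDer b w ∈ Fil k n (w.length + r) := by
  induction w with
  | nil => exact zero_mem _
  | cons i w ih =>
    rw [wordDer, List.length_cons]
    refine add_mem (Fil_anti ?_ (Fil_mul (hb i) (monom_mem_Fil w)))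
      (Fil_anti ?_ (Fil_mul (X_mem_Fil i) ih)) <;> omega

theorem wordDer_append (b : Fin n → Ass k n) (v w : List (Fin n)) :
    wordDer b (v ++ w) = wordDer b v * monom k w + monom k v * wordDer b w := by
  induction v with
  | nil => simp [wordDer, monom_nil]
  | cons i v ih =>
    change b i * monom k (v ++ w) + X i * wordDer b (v ++ w) =
      (b i * monom k v + X i * wordDer b v) * monom k w + X i * monom k v * wordDer b w
    rw [ih, monom_append]
    noncomm_ring

/-- `derivation b` unfolds to `wordExt (wordDer b)`, so all facts about continuous extensions apply
to it; the same holds for `subst`. -/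
theorem raises_derivation {r : ℕ} {b : Fin n → Ass k n} (hb : ∀ i, b i ∈ Fil k n (r + 1)) :
    Raises r (derivation b) := raises_wordExt (wordDer_mem_Fil hb)

theorem derivation_monom {b : Fin n → Ass k n} (hb : ∀ i, b i ∈ Fil k n 1) (w : List (Fin n)) :
    derivation b (monom k w) = wordDer b w :=
  wordExt_monom (fun w => wordDer_mem_Fil (r := 0) hb w) w

theorem derivation_X {b : Fin n → Ass k n} (hb : ∀ i, b i ∈ Fil k n 1) (i : Fin n) :
    derivation b (X i) = b i := by
  have h := derivation_monom hb [i]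
  simpa [monom, wordDer] using h

/-- On two words Leibniz is `wordDer_append`. Both sides are continuous in each argument, so the
rule extends first in g, with f a word, and then in f. -/
theorem isDer_derivation {b : Fin n → Ass k n} (hb : ∀ i, b i ∈ Fil k n 1) :
    IsDer (derivation b) := by
  have hr : Raises 0 (derivation b) := raises_derivation (r := 0) hb
  refine ⟨hr, fun f g => ?_⟩
  have hword : ∀ v, derivation b (monom k v * g) =
      derivation b (monom k v) * g + monom k v * derivation b g := by
    intro v
    refine raises_ext (T := derivation b ∘ₗ LinearMap.mulLeft k (monom k v))
      (S := LinearMap.mulLeft k (derivation b (monom k v)) +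
        LinearMap.mulLeft k (monom k v) ∘ₗ derivation b) ?_ ?_ (fun w => ?_) g
    · exact hr.comp_zero (raises_mulLeft (mem_Fil_zero _))
    · exact (raises_mulLeft (mem_Fil_zero _)).add
        ((raises_mulLeft (mem_Fil_zero _)).comp_zero hr)
    · simp only [LinearMap.comp_apply, LinearMap.add_apply, LinearMap.mulLeft_apply]
      rw [← monom_append, derivation_monom hb, derivation_monom hb, derivation_monom hb,
        wordDer_append]
  refine raises_ext (T := derivation b ∘ₗ LinearMap.mulRight k g)
      (S := LinearMap.mulRight k g ∘ₗ derivation b +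
        LinearMap.mulRight k (derivation b g)) ?_ ?_ (fun w => ?_) f
  · exact hr.comp_zero (raises_mulRight (mem_Fil_zero _))
  · exact ((raises_mulRight (mem_Fil_zero _)).comp_zero hr).add
      (raises_mulRight (mem_Fil_zero _))
  · simpa only [LinearMap.comp_apply, LinearMap.add_apply, LinearMap.mulRight_apply] using hword w

/-! ### The Euler derivation -/

theorem isDer_euler : IsDer (euler : Module.End k (Ass k n)) := isDer_derivation X_mem_Fil

theorem euler_X (i : Fin n) : euler (X i : Ass k n) = X i := derivation_X X_mem_Fil i

theorem euler_monom (w : List (Fin n)) :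
    euler (monom k w) = (w.length : k) • monom k w := by
  induction w with
  | nil => rw [monom_nil, isDer_euler.map_one]; simp
  | cons i w ih =>
    rw [monom_cons, isDer_euler.leibniz, ih, euler_X, List.length_cons, mul_smul_comm]
    push_cast
    rw [add_smul, one_smul, add_comm]

theorem euler_apply (f : Ass k n) (w : List (Fin n)) : euler f w = (w.length : k) * f w := by
  let T : Module.End k (Ass k n) :=
    { toFun := fun f => Ass.of fun w => (w.length : k) * f w
      map_add' := fun f g => by ext w; simp [mul_add]
      map_smul' := fun c f => by ext w; simp [mul_left_comm] }
  have hT : Raises 0 T := fun N f hf w hw => by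
    change (w.length : k) * f w = 0
    rw [hf w hw, mul_zero]
  have h : euler f = T f := by
    refine raises_ext isDer_euler.raises hT (fun v => ?_) f
    rw [euler_monom]
    ext w
    change _ = (w.length : k) * monom k v w
    rw [Ass.smul_apply, monom_apply]
    split_ifs with hw
    · rw [hw]
    · simp
  rw [h]
  rfl

/-! ### Substitution -/

theorem raises_subst {a : Fin m → Ass k n} (ha : ∀ i, a i ∈ Fil k n 1) : Raises 0 (subst a) :=
  raises_wordExt (r := 0) (φ := fun w => (w.map a).prod) fun w => prod_mem_Fil ha w

theorem subst_monom {a : Fin m → Ass k n} (ha : ∀ i, a i ∈ Fil k n 1) (w : List (Fin m)) :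
    subst a (monom k w) = (w.map a).prod := wordExt_monom (prod_mem_Fil ha) w

theorem subst_one {a : Fin m → Ass k n} (ha : ∀ i, a i ∈ Fil k n 1) : subst a 1 = 1 :=
  subst_monom ha []

theorem subst_X {a : Fin m → Ass k n} (ha : ∀ i, a i ∈ Fil k n 1) (i : Fin m) :
    subst a (X i) = a i := by
  have h := subst_monom ha [i]
  simpa [monom] using h

theorem subst_mul {a : Fin m → Ass k n} (ha : ∀ i, a i ∈ Fil k n 1) (f g : Ass k m) :
    subst a (f * g) = subst a f * subst a g := by
  have hr := raises_subst ha
  have hword : ∀ v, subst a (monom k v * g) = subst a (monom k v) * subst a g := by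
    intro v
    refine raises_ext (T := subst a ∘ₗ LinearMap.mulLeft k (monom k v))
      (S := LinearMap.mulLeft k (subst a (monom k v)) ∘ₗ subst a) ?_ ?_ (fun w => ?_) g
    · exact hr.comp_zero (raises_mulLeft (mem_Fil_zero _))
    · exact (raises_mulLeft (mem_Fil_zero _)).comp_zero hr
    · simp only [LinearMap.comp_apply, LinearMap.mulLeft_apply]
      rw [← monom_append, subst_monom ha, subst_monom ha, subst_monom ha, List.map_append,
        List.prod_append]
  refine raises_ext (T := subst a ∘ₗ LinearMap.mulRight k g)
      (S := LinearMap.mulRight k (subst a g) ∘ₗ subst a) ?_ ?_ (fun w => ?_) f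
  · exact hr.comp_zero (raises_mulRight (mem_Fil_zero _))
  · exact (raises_mulRight (mem_Fil_zero _)).comp_zero hr
  · simpa only [LinearMap.comp_apply, LinearMap.mulRight_apply] using hword w

/-- Continuous unital algebra endomorphisms commute with substitution. -/
theorem map_subst {T : Module.End k (Ass k n)} (hT : Raises 0 T) (h1 : T 1 = 1)
    (hmul : ∀ f g, T (f * g) = T f * T g) {a b : Fin m → Ass k n} (ha : ∀ i, a i ∈ Fil k n 1)
    (hab : ∀ i, T (a i) = b i) (f : Ass k m) :
    T (subst a f) = subst b f := by
  have hb : ∀ i, b i ∈ Fil k n 1 := fun i => hab i ▸ hT 1 _ (ha i)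
  refine raises_ext (T := T ∘ₗ subst a) (hT.comp_zero (raises_subst ha)) (raises_subst hb)
    (fun w => ?_) f
  rw [LinearMap.comp_apply, subst_monom ha, subst_monom hb]
  induction w with
  | nil => exact h1
  | cons i w ih => rw [List.map_cons, List.prod_cons, hmul, ih, List.map_cons, List.prod_cons, hab]

/-- A derivation acting on `x_i` as an inner derivation acts so on the series in `x_i`. -/
theorem IsDer.map_subst_of_inner {D : Module.End k (Ass k n)} (hD : IsDer D) {z a : Ass k n}
    (hz : z ∈ Fil k n 1) (h : D z = ad z a) (f : Ass k m) :
    D (subst (fun _ => z) f) = ad (subst (fun _ => z) f) a := by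
  have hr := raises_subst (k := k) (m := m) (fun _ => hz)
  refine raises_ext (T := D ∘ₗ subst fun _ => z)
    (S := (-ad a) ∘ₗ subst fun _ => z) (hD.raises.comp_zero hr)
    ((raises_ad (mem_Fil_zero a)).neg.comp_zero hr) (fun w => ?_) f |>.trans ?_
  · simp only [LinearMap.comp_apply, subst_monom (fun _ => hz), LinearMap.neg_apply, ad_apply]
    induction w with
    | nil => simp [hD.map_one]
    | cons i w ih =>
      rw [List.map_cons, List.prod_cons, hD.leibniz, ih, h, ad_apply]
      noncomm_ring
  · simp only [LinearMap.comp_apply, LinearMap.neg_apply, ad_apply]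
    noncomm_ring

/-- Here z is homogeneous of degree one, so substituting it preserves degree. It is used for z = x,
y and x + y; ch(x,y) would not qualify. -/
theorem euler_subst {z : Ass k n} (hz : z ∈ Fil k n 1) (h : euler z = z) (f : Ass k m) :
    euler (subst (fun _ => z) f) = subst (fun _ => z) (euler f) := by
  have hr := raises_subst (k := k) (m := m) (fun _ => hz)
  refine raises_ext (T := euler ∘ₗ subst fun _ => z) (S := (subst fun _ => z) ∘ₗ euler)
    (isDer_euler.raises.comp_zero hr) (hr.comp_zero isDer_euler.raises) (fun w => ?_) f
  simp only [LinearMap.comp_apply, euler_monom, map_smul, subst_monom (fun _ => hz)]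
  induction w with
  | nil => simp [isDer_euler.map_one]
  | cons i w ih =>
    rw [List.map_cons, List.prod_cons, isDer_euler.leibniz, ih, h, List.length_cons,
      mul_smul_comm]
    push_cast
    rw [add_smul, one_smul, add_comm]

/-! ### Cyclic words -/

/-- The sum of the coefficients over the rotations of a word. -/
def cyc : Module.End k (Ass k n) where
  toFun f := Ass.of fun w => ∑ i ∈ Finset.range w.length, f (w.rotate i)
  map_add' f g := by ext w; simp [Finset.sum_add_distrib]
  map_smul' c f := by ext w; simp [Finset.mul_sum]

theorem cyc_apply (f : Ass k n) (w : List (Fin n)) :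
    cyc f w = ∑ i ∈ Finset.range w.length, f (w.rotate i) := rfl

theorem raises_cyc : Raises 0 (cyc : Module.End k (Ass k n)) := fun N f hf w hw => by
  rw [cyc_apply]
  exact Finset.sum_eq_zero fun i _ => hf _ (by rw [List.length_rotate]; exact hw)

theorem sum_range_rotate {M : Type*} [AddCommMonoid M] (φ : List (Fin n) → M)
    (w : List (Fin n)) (j : ℕ) :
    ∑ i ∈ Finset.range w.length, φ (w.rotate (i + j)) =
      ∑ i ∈ Finset.range w.length, φ (w.rotate i) := by
  induction j with
  | zero => rfl
  | succ j ih =>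
    rw [← ih]
    have h1 := Finset.sum_range_succ (fun i => φ (w.rotate (i + j))) w.length
    have h2 := Finset.sum_range_succ' (fun i => φ (w.rotate (i + j))) w.length
    have h3 : w.rotate (w.length + j) = w.rotate (0 + j) := by
      rw [← List.rotate_rotate, List.rotate_length, zero_add]
    cases hw : w.length with
    | zero => rfl
    | succ L =>
      rw [hw] at h1 h2 h3
      rw [Finset.sum_range_succ, Finset.sum_range_succ' (fun i => φ (w.rotate (i + j)))]
      rw [show L + (j + 1) = L + 1 + j by ring, h3]
      congr 1
      exact Finset.sum_congr rfl fun i _ => by rw [show i + (j + 1) = i + 1 + j by ring]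

/-- Cutting a rotated word into pieces of lengths N - j and j and swapping them is a further
rotation, and summing over all rotations absorbs it. -/
theorem cyc_mul_comm (f g : Ass k n) : cyc (f * g) = cyc (g * f) := by
  ext w
  have key : ∀ a b : Ass k n, cyc (a * b) w = ∑ j ∈ Finset.range (w.length + 1),
      ∑ i ∈ Finset.range w.length, a ((w.rotate i).take j) * b ((w.rotate i).drop j) := by
    intro a b
    rw [cyc_apply, Finset.sum_comm]
    refine Finset.sum_congr rfl fun i _ => ?_
    rw [Ass.mul_apply, List.length_rotate]
  rw [key, key, ← Finset.sum_range_reflect]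
  refine Finset.sum_congr rfl fun j hj => ?_
  rw [Finset.mem_range] at hj
  rw [← sum_range_rotate (fun v => g (v.take j) * f (v.drop j)) w (w.length - j)]
  refine Finset.sum_congr rfl fun i _ => ?_
  have hl : w.length + 1 - 1 - j = w.length - j := by omega
  have hrot : w.rotate (i + (w.length - j)) =
      (w.rotate i).drop (w.length - j) ++ (w.rotate i).take (w.length - j) := by
    rw [← List.rotate_rotate, List.rotate_eq_drop_append_take]
    rw [List.length_rotate]
    omega
  have hlen : ((w.rotate i).drop (w.length - j)).length = j := by
    rw [List.length_drop, List.length_rotate]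
    omega
  rw [hl, hrot, List.take_left' hlen, List.drop_left' hlen, mul_comm]

theorem cyc_ad (f g : Ass k n) : cyc (ad f g) = 0 := by
  rw [ad_apply, map_sub, cyc_mul_comm, sub_self]

theorem cyc_one : cyc (1 : Ass k n) = 0 := by
  ext w
  rw [cyc_apply]
  refine Finset.sum_eq_zero fun i hi => ?_
  rw [Finset.mem_range] at hi
  rw [Ass.one_apply, if_neg]
  intro h
  rw [List.rotate_eq_nil_iff] at h
  simp [h] at hi

/-- A series with vanishing cyclic sums is a constant plus a sum of commutators. -/
theorem exists_commutators_of_cyc_eq_zero [CharZero k] {f : Ass k n} (hf : cyc f = 0) :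
    ∃ b : Fin n → Ass k n, f = f [] • (1 : Ass k n) + ∑ i, ad (X i) (b i) := by
  -- This g solves g(w) - g(rot w) = f(w) on each orbit of rotations, which is possible because the
  -- sum of f over the orbit is zero. Weighting by j and dividing by the length also handles
  -- periodic words.
  let g : Ass k n := Ass.of fun w =>
    -((w.length : k)⁻¹ * ∑ j ∈ Finset.range w.length, (j : k) * f (w.rotate j))
  have hg : ∀ w : List (Fin n), w ≠ [] → g w - g (w.rotate 1) = f w := by
    intro w hw
    have hN : (w.length : k) ≠ 0 := by
      rw [Nat.cast_ne_zero, Ne, List.length_eq_zero_iff]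
      exact hw
    have hc : ∑ j ∈ Finset.range w.length, f (w.rotate (j + 1)) = 0 := by
      rw [sum_range_rotate f w 1, ← cyc_apply, hf]
      rfl
    -- The sum of j · f(rot^j w) over 0 ≤ j ≤ N, split off at either end, compares the weighted sums
    -- for w and for rot w.
    have hs := Finset.sum_range_succ (fun j => (j : k) * f (w.rotate j)) w.length
    rw [Finset.sum_range_succ'] at hs
    simp only [Nat.cast_add, Nat.cast_one, add_mul, one_mul, Finset.sum_add_distrib, hc,
      Nat.cast_zero, zero_mul, add_zero, List.rotate_length] at hs
    have hr : ∀ j, (w.rotate 1).rotate j = w.rotate (j + 1) := fun j => by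
      rw [List.rotate_rotate, add_comm]
    simp only [g, Ass.of_apply, List.length_rotate, hr, hs]
    field_simp
    ring
  -- With this b, the products b_i x_i sum to -g, and the products x_i b_i read off -g on the word
  -- rotated by one letter.
  refine ⟨fun i => Ass.of fun w => -g (w ++ [i]), ?_⟩
  ext w
  simp only [Ass.add_apply, Ass.smul_apply, Ass.sum_apply, ad_apply, Ass.sub_apply,
    Ass.one_apply, Finset.sum_sub_distrib]
  by_cases hw : w = []
  · subst hw
    simp [X_mul_nil, mul_X_nil]
  · have h1 : ∑ i, (X i * Ass.of fun w => -g (w ++ [i]) : Ass k n) w = -g (w.rotate 1) := by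
      cases w with
      | nil => exact absurd rfl hw
      | cons j v =>
        simp [X_mul_cons]
    have h2 : ∑ i, ((Ass.of fun w => -g (w ++ [i])) * X i : Ass k n) w = -g w := by
      obtain ⟨v, j, rfl⟩ := List.eq_nil_or_concat' w |>.resolve_left hw
      simp [mul_X_append]
    rw [h1, h2, ← hg w hw, if_neg hw]
    ring

/-- A derivation sends commutators to sums of commutators; this is its action on tr_n. -/
theorem IsDer.cyc_eq_zero [CharZero k] {D : Module.End k (Ass k n)} (hD : IsDer D) {f : Ass k n}
    (hf : cyc f = 0) : cyc (D f) = 0 := by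
  obtain ⟨b, hb⟩ := exists_commutators_of_cyc_eq_zero hf
  rw [hb, map_add, map_smul, hD.map_one, smul_zero, zero_add, map_sum, map_sum]
  refine Finset.sum_eq_zero fun i _ => ?_
  have : D (ad (X i) (b i)) = ad (D (X i)) (b i) + ad (X i) (D (b i)) := by
    simp only [ad_apply, map_sub, hD.leibniz]
    noncomm_ring
  rw [this, map_add, cyc_ad, cyc_ad, add_zero]

/-- Two series have the same image in `tr_n` exactly if their cyclic sums agree. -/
theorem Tr_eq_iff [CharZero k] (f g : Ass k n) : Tr f = Tr g ↔ cyc f = cyc g := by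
  rw [← sub_eq_zero, ← map_sub, ← sub_eq_zero (a := cyc f), ← map_sub]
  generalize f - g = h
  rw [Tr, LinearMap.comp_apply, Submodule.mkQ_apply, Submodule.Quotient.mk_eq_zero, commutators,
    Submodule.mem_comap]
  have hd : (AssPlus k n).subtype (dropConst h) = h - h [] • (1 : Ass k n) := rfl
  rw [hd]
  constructor
  · intro hm
    have hle : Submodule.span k {c : Ass k n | ∃ a b, c = a * b - b * a} ≤ LinearMap.ker cyc := by
      rw [Submodule.span_le]
      rintro _ ⟨a, b, rfl⟩
      exact cyc_ad a b
    have h0 : cyc (h - h [] • (1 : Ass k n)) = 0 := hle hm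
    rwa [map_sub, map_smul, cyc_one, smul_zero, sub_zero] at h0
  · intro hc
    obtain ⟨b, hb⟩ := exists_commutators_of_cyc_eq_zero hc
    rw [sub_eq_of_eq_add' hb]
    -- One commutator per generator suffices even for an infinite series, so the algebraic span
    -- needs no closure.
    exact sum_mem fun i _ => Submodule.subset_span ⟨X i, b i, rfl⟩

/-! ### Exponentials and logarithms -/

theorem inv_factorial_mul_choose [CharZero k] (p q : ℕ) :
    ((p + q).factorial : k)⁻¹ * (p + q).choose p = (p.factorial : k)⁻¹ * (q.factorial : k)⁻¹ := by
  have h1 : ((p + q).factorial : k) ≠ 0 := by exact_mod_cast Nat.factorial_ne_zero _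
  have h2 : (p.factorial : k) ≠ 0 := by exact_mod_cast Nat.factorial_ne_zero _
  have h3 : (q.factorial : k) ≠ 0 := by exact_mod_cast Nat.factorial_ne_zero _
  have h4 : ((p + q).choose p : k) * p.factorial * q.factorial = (p + q).factorial := by
    rw [Nat.choose_symm_add]
    exact_mod_cast Nat.add_choose_mul_factorial_mul_factorial p q
  field_simp
  linear_combination h4

/-- The binomial theorem divided by d!. It is stated in any algebra because it serves for series,
for operators, for operators on operators and for scalars. -/
theorem sum_antidiagonal_inv_factorial [CharZero k] {A : Type*} [Ring A] [Algebra k A] {a b : A}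
    (h : Commute a b) (d : ℕ) :
    ∑ x ∈ Finset.HasAntidiagonal.antidiagonal d,
      ((x.1.factorial : k)⁻¹ * (x.2.factorial : k)⁻¹) • (a ^ x.1 * b ^ x.2) =
      (d.factorial : k)⁻¹ • (a + b) ^ d := by
  rw [h.add_pow', Finset.smul_sum]
  refine Finset.sum_congr rfl fun x hx => ?_
  rw [Finset.HasAntidiagonal.mem_antidiagonal] at hx
  rw [← Nat.cast_smul_eq_nsmul k, smul_smul, ← hx, inv_factorial_mul_choose]

theorem expA_term_mem {a : Ass k n} (ha : a ∈ Fil k n 1) (d : ℕ) :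
    (d.factorial : k)⁻¹ • a ^ d ∈ Fil k n d := Submodule.smul_mem _ _ (Fil_pow ha d)

theorem expA_mul [CharZero k] {a b : Ass k n} (ha : a ∈ Fil k n 1) (hb : b ∈ Fil k n 1)
    (h : Commute a b) : expA a * expA b = expA (a + b) := by
  have h1 := map_seriesSum (raises_mulRight (r := 0) (mem_Fil_zero (expA b))) (expA_term_mem ha)
  simp only [LinearMap.mulRight_apply] at h1
  have h2 : ∀ p : ℕ, ((p.factorial : k)⁻¹ • a ^ p) * expA b =
      seriesSum fun q => ((p.factorial : k)⁻¹ • a ^ p) * ((q.factorial : k)⁻¹ • b ^ q) := fun p =>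
    map_seriesSum (raises_mulLeft (r := 0) (mem_Fil_zero _)) (expA_term_mem hb)
  rw [expA, h1]
  simp only [h2]
  rw [seriesSum_seriesSum fun p q => Fil_mul (expA_term_mem ha p) (expA_term_mem hb q)]
  simp only [smul_mul_smul_comm, sum_antidiagonal_inv_factorial h]
  rfl

theorem expA_zero : expA (0 : Ass k n) = 1 := by
  rw [expA, seriesSum_eq_zero_term]
  · simp
  · intro d hd
    simp [hd]

theorem expA_mul_neg [CharZero k] {a : Ass k n} (ha : a ∈ Fil k n 1) :
    expA a * expA (-a) = 1 := by
  rw [expA_mul ha (neg_mem ha) (Commute.refl a).neg_right, add_neg_cancel, expA_zero]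

theorem expA_neg_mul [CharZero k] {a : Ass k n} (ha : a ∈ Fil k n 1) :
    expA (-a) * expA a = 1 := by
  rw [expA_mul (neg_mem ha) ha (Commute.refl a).neg_left, neg_add_cancel, expA_zero]

theorem expA_sub_mem_Fil_two {a : Ass k n} (ha : a ∈ Fil k n 1) :
    expA a - (1 + a) ∈ Fil k n 2 := by
  have h := seriesSum_sub_mem_Fil (expA_term_mem ha) 2
  simpa [Finset.sum_range_succ, expA] using h

theorem commute_seriesSum {a : Ass k n} {c : ℕ → Ass k n} (hc : ∀ d, c d ∈ Fil k n d)
    (h : ∀ d, Commute a (c d)) : Commute a (seriesSum c) := by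
  have h1 := map_seriesSum (raises_mulLeft (r := 0) (mem_Fil_zero a)) hc
  have h2 := map_seriesSum (raises_mulRight (r := 0) (mem_Fil_zero a)) hc
  simp only [LinearMap.mulLeft_apply, LinearMap.mulRight_apply] at h1 h2
  rw [Commute, SemiconjBy, h1, h2]
  congr 1
  funext d
  exact h d

theorem logA_term_mem {g : Ass k n} (hg : g - 1 ∈ Fil k n 1) (d : ℕ) :
    ((-1 : k) ^ d / ((d : k) + 1)) • (g - 1) ^ (d + 1) ∈ Fil k n (d + 1) :=
  Submodule.smul_mem _ _ (Fil_pow hg (d + 1))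

theorem logA_term_mem' {g : Ass k n} (hg : g - 1 ∈ Fil k n 1) (d : ℕ) :
    ((-1 : k) ^ d / ((d : k) + 1)) • (g - 1) ^ (d + 1) ∈ Fil k n d :=
  Fil_anti (Nat.le_succ d) (logA_term_mem hg d)

theorem logA_mem_Fil {g : Ass k n} (hg : g - 1 ∈ Fil k n 1) : logA g ∈ Fil k n 1 :=
  seriesSum_mem_Fil fun d => Fil_anti (by omega) (logA_term_mem hg d)

theorem logA_sub_mem_Fil_two {g : Ass k n} (hg : g - 1 ∈ Fil k n 1) :
    logA g - (g - 1) ∈ Fil k n 2 := by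
  rw [logA, seriesSum_succ (logA_term_mem' hg)]
  simp only [pow_zero, Nat.cast_zero, zero_add, div_one, one_smul, pow_one, add_sub_cancel_left]
  exact seriesSum_mem_Fil fun d => Fil_anti (by omega) (logA_term_mem hg (d + 1))

theorem commute_logA {g a : Ass k n} (hg : g - 1 ∈ Fil k n 1) (h : Commute a g) :
    Commute a (logA g) :=
  commute_seriesSum (logA_term_mem' hg) fun _ =>
    Commute.smul_right ((h.sub_right (Commute.one_right a)).pow_right _) _

theorem map_pow_of_mul {T : Ass k m →ₗ[k] Ass k n} (h1 : T 1 = 1)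
    (hmul : ∀ f g, T (f * g) = T f * T g) (a : Ass k m) (d : ℕ) : T (a ^ d) = T a ^ d := by
  induction d with
  | zero => simpa using h1
  | succ d ih => rw [pow_succ, hmul, ih, pow_succ]

theorem map_expA {T : Ass k m →ₗ[k] Ass k n} (hT : Raises 0 T) (h1 : T 1 = 1)
    (hmul : ∀ f g, T (f * g) = T f * T g) {a : Ass k m} (ha : a ∈ Fil k m 1) :
    T (expA a) = expA (T a) := by
  rw [expA, map_seriesSum hT (expA_term_mem ha)]
  simp only [map_smul, map_pow_of_mul h1 hmul]
  rfl

theorem map_logA {T : Ass k m →ₗ[k] Ass k n} (hT : Raises 0 T) (h1 : T 1 = 1)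
    (hmul : ∀ f g, T (f * g) = T f * T g) {g : Ass k m} (hg : g - 1 ∈ Fil k m 1) :
    T (logA g) = logA (T g) := by
  rw [logA, map_seriesSum hT (logA_term_mem' hg)]
  simp only [map_smul, map_pow_of_mul h1 hmul, map_sub, h1]
  rfl

theorem logA_conj {g u v : Ass k n} (hg : g - 1 ∈ Fil k n 1) (huv : u * v = 1) (hvu : v * u = 1) :
    logA (u * g * v) = u * logA g * v := by
  have h := map_logA (T := LinearMap.mulLeft k u ∘ₗ LinearMap.mulRight k v) (g := g)
    ((raises_mulLeft (mem_Fil_zero u)).comp_zero (raises_mulRight (mem_Fil_zero v)))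
    (by simpa using huv) (fun f g => by
      simp only [LinearMap.comp_apply, LinearMap.mulLeft_apply, LinearMap.mulRight_apply]
      calc u * (f * g * v) = u * f * 1 * g * v := by noncomm_ring
        _ = u * (f * v) * (u * (g * v)) := by rw [← hvu]; noncomm_ring) hg
  simpa only [LinearMap.comp_apply, LinearMap.mulLeft_apply, LinearMap.mulRight_apply,
    mul_assoc] using h.symm

theorem IsDer.map_pow {D : Module.End k (Ass k n)} (hD : IsDer D) {c : Ass k n}
    (h : Commute c (D c)) (d : ℕ) : D (c ^ (d + 1)) = ((d : k) + 1) • (c ^ d * D c) := by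
  induction d with
  | zero => simp
  | succ d ih =>
    rw [pow_succ', hD.leibniz, ih, mul_smul_comm, ← mul_assoc, ← pow_succ',
      ← (h.pow_left (d + 1)).eq]
    push_cast
    rw [add_smul ((d : k) + 1), one_smul, add_comm]

theorem IsDer.map_expA [CharZero k] {D : Module.End k (Ass k n)} (hD : IsDer D) {c : Ass k n}
    (hc : c ∈ Fil k n 1) (h : Commute c (D c)) : D (expA c) = expA c * D c := by
  have h1 := map_seriesSum (raises_mulRight (r := 0) (mem_Fil_zero (D c))) (expA_term_mem hc)
  simp only [LinearMap.mulRight_apply] at h1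
  rw [expA, map_seriesSum hD.raises (expA_term_mem hc), h1,
    seriesSum_succ fun d => hD.raises _ _ (expA_term_mem hc d)]
  simp only [pow_zero, Nat.factorial_zero, Nat.cast_one, inv_one, one_smul, hD.map_one, zero_add]
  congr 1
  funext d
  rw [map_smul, hD.map_pow h, smul_smul, smul_mul_assoc]
  congr 1
  have h2 : (d.factorial : k) ≠ 0 := by exact_mod_cast Nat.factorial_ne_zero _
  have h3 : (d : k) + 1 ≠ 0 := by exact_mod_cast Nat.succ_ne_zero d
  rw [Nat.factorial_succ]
  push_cast
  field_simp

/-- With z = g - 1, D(ln g) is the geometric series ∑ (-z)^d D(g), and multiplication by 1 + z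
telescopes it. -/
theorem IsDer.mul_map_logA [CharZero k] {D : Module.End k (Ass k n)} (hD : IsDer D) {g : Ass k n}
    (hg : g - 1 ∈ Fil k n 1) (h : Commute g (D g)) : g * D (logA g) = D g := by
  set z := g - 1 with hz
  have hDz : D z = D g := by rw [hz, map_sub, hD.map_one, sub_zero]
  have hcomm : Commute z (D z) := by rw [hDz]; exact h.sub_left (Commute.one_left _)
  let c : ℕ → Ass k n := fun d => (-1 : k) ^ d • (z ^ d * D g)
  have hc : ∀ d, c d ∈ Fil k n d := fun d =>
    Submodule.smul_mem _ _ (Fil_mul (Fil_pow hg d) (mem_Fil_zero (D g)))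
  have h1 : D (logA g) = seriesSum c := by
    rw [logA, map_seriesSum hD.raises (logA_term_mem' hg)]
    congr 1
    funext d
    rw [map_smul, ← hz, hD.map_pow hcomm, smul_smul, hDz]
    have h3 : (d : k) + 1 ≠ 0 := by exact_mod_cast Nat.succ_ne_zero d
    rw [div_mul_cancel₀ _ h3]
  have h2 : z * seriesSum c = -seriesSum fun d => c (d + 1) := by
    have := map_seriesSum (raises_mulLeft (r := 0) (mem_Fil_zero z)) hc
    simp only [LinearMap.mulLeft_apply] at this
    rw [this, ← map_neg]
    congr 1
    funext d
    simp only [c, Pi.neg_apply, mul_smul_comm, ← mul_assoc, pow_succ']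
    simp
  have h3 : g = 1 + z := by rw [hz]; abel
  rw [h1, h3, add_mul, one_mul, h2, seriesSum_succ hc, add_neg_cancel_right]
  simp [c, ← h3]

/-- A differential equation argument in one variable. With h the difference of the two sides, (1 +
z) l(h) = z h; this pushes h up one degree at a time, since l multiplies degree N by the invertible
scalar N. -/
theorem expA_logA_X [CharZero k] (i : Fin 1) :
    expA (logA (1 + X i : Ass k 1)) = 1 + X i := by
  set z : Ass k 1 := X i
  have hz : z ∈ Fil k 1 1 := X_mem_Fil i
  have hg : (1 + z) - 1 ∈ Fil k 1 1 := by rwa [add_sub_cancel_left]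
  have hE := isDer_euler (k := k) (n := 1)
  have hEg : euler (1 + z) = z := by rw [map_add, hE.map_one, zero_add, euler_X]
  set c := logA (1 + z)
  have hc : c ∈ Fil k 1 1 := logA_mem_Fil hg
  have h1 : (1 + z) * euler c = z := by
    rw [hE.mul_map_logA hg (Ass.mul_comm_one _ _), hEg]
  have h2 : euler (expA c) = expA c * euler c := hE.map_expA hc (Ass.mul_comm_one _ _)
  set h := expA c - (1 + z) with hh
  have h3 : (1 + z) * euler h = z * h := by
    rw [hh, map_sub, hEg, h2, mul_sub, ← mul_assoc, Ass.mul_comm_one (1 + z) (expA c), mul_assoc,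
      h1, mul_sub, Ass.mul_comm_one z, Ass.mul_comm_one z (1 + z)]
  have h4 : euler h = z * h - z * euler h := by
    rw [← h3]
    noncomm_ring
  have h5 : ∀ N, h ∈ Fil k 1 (N + 1) := by
    intro N
    induction N with
    | zero =>
      have := Fil_anti (show 1 ≤ 2 by omega) (expA_sub_mem_Fil_two hc)
      have h6 : h = expA c - (1 + c) + (c - z) := by rw [hh]; abel
      rw [h6]
      exact add_mem this (sub_mem hc hz)
    | succ N ih =>
      have h6 : euler h ∈ Fil k 1 (1 + (N + 1)) := by
        rw [h4]
        exact sub_mem (Fil_mul hz ih) (Fil_mul hz (hE.raises _ _ ih))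
      intro w hw
      by_cases hw0 : w.length < 1
      · exact ih w (by omega)
      · have := h6 w (by omega)
        rw [euler_apply, mul_eq_zero] at this
        refine this.resolve_left ?_
        rw [← Ne, Nat.cast_ne_zero]
        omega
  exact sub_eq_zero.1 (eq_zero_of_mem_Fil fun N => Fil_anti (Nat.le_succ N) (h5 N))

/-- Substitution of g - 1 for the variable transports the one-variable identity. -/
theorem expA_logA [CharZero k] {g : Ass k n} (hg : g - 1 ∈ Fil k n 1) : expA (logA g) = g := by
  have ha : ∀ _ : Fin 1, g - 1 ∈ Fil k n 1 := fun _ => hg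
  have hX : (1 + X 0 : Ass k 1) - 1 ∈ Fil k 1 1 := by
    rw [add_sub_cancel_left]
    exact X_mem_Fil 0
  have h := congrArg (subst fun _ => g - 1) (expA_logA_X (k := k) 0)
  rw [map_expA (raises_subst ha) (subst_one ha) (subst_mul ha) (logA_mem_Fil hX),
    map_logA (raises_subst ha) (subst_one ha) (subst_mul ha) hX, map_add, subst_one ha,
    subst_X ha, add_sub_cancel] at h
  exact h

/-! ### Exponentials of operators -/

theorem expEnd_apply (T : Module.End k (Ass k n)) (f : Ass k n) :
    expEnd T f = seriesSum fun d => (d.factorial : k)⁻¹ • (T ^ d) f := by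
  ext w
  simp [expEnd, seriesSum_apply]

theorem expSubOneDiv_apply (T : Module.End k (Ass k n)) (f : Ass k n) :
    expSubOneDiv T f = seriesSum fun d => ((d + 1).factorial : k)⁻¹ • (T ^ d) f := by
  ext w
  simp [expSubOneDiv, seriesSum_apply]

theorem pow_term_mem {T : Module.End k (Ass k n)} (hT : Raises 1 T) {N : ℕ} {f : Ass k n}
    (hf : f ∈ Fil k n N) (c : k) (d : ℕ) : c • (T ^ d) f ∈ Fil k n (N + d) :=
  Submodule.smul_mem _ _ (hT.pow d N f hf)

theorem pow_term_mem_zero {T : Module.End k (Ass k n)} (hT : Raises 1 T) (f : Ass k n)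
    (c : ℕ → k) (d : ℕ) : c d • (T ^ d) f ∈ Fil k n d :=
  Fil_anti (by omega) (pow_term_mem hT (mem_Fil_zero f) (c d) d)

theorem raises_expEnd {T : Module.End k (Ass k n)} (hT : Raises 1 T) : Raises 0 (expEnd T) :=
  fun N f hf => by
    rw [expEnd_apply]
    exact seriesSum_mem_Fil fun d => Fil_anti (by omega) (pow_term_mem hT hf _ d)

theorem expEnd_sub_mem_Fil {T : Module.End k (Ass k n)} (hT : Raises 1 T) {N : ℕ} {f : Ass k n}
    (hf : f ∈ Fil k n N) : expEnd T f - f ∈ Fil k n (N + 1) := by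
  rw [expEnd_apply, seriesSum_succ (pow_term_mem_zero hT f fun d => (d.factorial : k)⁻¹)]
  simp only [Nat.factorial_zero, Nat.cast_one, inv_one, pow_zero, one_smul, Module.End.one_apply,
    add_sub_cancel_left]
  exact seriesSum_mem_Fil fun d => Fil_anti (by omega) (pow_term_mem hT hf _ (d + 1))

/-- Regroups a product of two operator series around A by total degree, with arbitrary coefficients.
Every product of exponential-type operators below reduces to it and a scalar identity. -/
theorem double_series {T A S : Module.End k (Ass k n)} (hT : Raises 1 T) (hA : Raises 0 A)
    (hS : Raises 1 S) (α β : ℕ → k) (f : Ass k n) :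
    (seriesSum fun p => α p • (T ^ p) (A (seriesSum fun q => β q • (S ^ q) f))) =
      seriesSum fun d => (∑ x ∈ Finset.HasAntidiagonal.antidiagonal d,
        (α x.1 * β x.2) • (T ^ x.1 * A * S ^ x.2)) f := by
  have h1 : ∀ p, α p • (T ^ p) (A (seriesSum fun q => β q • (S ^ q) f)) =
      seriesSum fun q => α p • (T ^ p) (A (β q • (S ^ q) f)) := fun p =>
    map_seriesSum (T := α p • (T ^ p * A)) (((hT.pow p).zero'.comp_zero hA).smul _)
      (pow_term_mem_zero hS f β)
  simp only [h1]
  rw [seriesSum_seriesSum]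
  · simp only [LinearMap.sum_apply, LinearMap.smul_apply, Module.End.mul_apply, map_smul, smul_smul]
  · intro p q
    rw [add_comm]
    exact pow_term_mem hT (hA _ _ (pow_term_mem_zero hS f β q)) _ p

theorem expEnd_expEnd [CharZero k] {T S : Module.End k (Ass k n)} (hT : Raises 1 T)
    (hS : Raises 1 S) (h : Commute T S) (f : Ass k n) :
    expEnd T (expEnd S f) = expEnd (T + S) f := by
  have h1 := double_series hT raises_one hS (fun p => (p.factorial : k)⁻¹)
    (fun q => (q.factorial : k)⁻¹) f
  simp only [mul_one, sum_antidiagonal_inv_factorial h, Module.End.one_apply] at h1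
  rw [expEnd_apply T, expEnd_apply S, h1, expEnd_apply]
  rfl

theorem expEnd_zero (f : Ass k n) : expEnd 0 f = f := by
  rw [expEnd_apply, seriesSum_eq_zero_term]
  · simp
  · intro d hd
    simp [hd]

theorem expEnd_expEnd_neg [CharZero k] {T : Module.End k (Ass k n)} (hT : Raises 1 T)
    (f : Ass k n) : expEnd T (expEnd (-T) f) = f := by
  rw [expEnd_expEnd hT hT.neg (Commute.refl T).neg_right, add_neg_cancel, expEnd_zero]

theorem expEnd_neg_expEnd [CharZero k] {T : Module.End k (Ass k n)} (hT : Raises 1 T)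
    (f : Ass k n) : expEnd (-T) (expEnd T f) = f := by
  rw [expEnd_expEnd hT.neg hT (Commute.refl T).neg_left, neg_add_cancel, expEnd_zero]

theorem expEnd_mulLeft {a : Ass k n} (ha : a ∈ Fil k n 1) (f : Ass k n) :
    expEnd (LinearMap.mulLeft k a) f = expA a * f := by
  have h := map_seriesSum (raises_mulRight (r := 0) (mem_Fil_zero f)) (expA_term_mem ha)
  simp only [LinearMap.mulRight_apply] at h
  rw [expEnd_apply, expA, h]
  simp only [LinearMap.pow_mulLeft, LinearMap.mulLeft_apply, smul_mul_assoc]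

theorem expEnd_mulRight {a : Ass k n} (ha : a ∈ Fil k n 1) (f : Ass k n) :
    expEnd (LinearMap.mulRight k a) f = f * expA a := by
  have h := map_seriesSum (raises_mulLeft (r := 0) (mem_Fil_zero f)) (expA_term_mem ha)
  simp only [LinearMap.mulLeft_apply] at h
  rw [expEnd_apply, expA, h]
  simp only [LinearMap.pow_mulRight, LinearMap.mulRight_apply, mul_smul_comm]

/-- ad_a is the sum of left multiplication by a and right multiplication by -a, which commute. -/
theorem expEnd_ad [CharZero k] {a : Ass k n} (ha : a ∈ Fil k n 1) (f : Ass k n) :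
    expEnd (ad a) f = expA a * f * expA (-a) := by
  have h : ad a = LinearMap.mulLeft k a + LinearMap.mulRight k (-a) := by
    ext f
    simp [ad_apply, sub_eq_add_neg]
  rw [h, ← expEnd_expEnd (raises_mulLeft ha) (raises_mulRight (neg_mem ha))
    (LinearMap.commute_mulLeft_right a (-a)), expEnd_mulLeft ha, expEnd_mulRight (neg_mem ha),
    mul_assoc]

theorem IsDer.pow_mul {D : Module.End k (Ass k n)} (hD : IsDer D) (f g : Ass k n) (d : ℕ) :
    (D ^ d) (f * g) = ∑ x ∈ Finset.HasAntidiagonal.antidiagonal d,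
      d.choose x.1 • ((D ^ x.1) f * (D ^ x.2) g) := by
  induction d with
  | zero => simp
  | succ d ih =>
    rw [Finset.sum_antidiagonal_choose_succ_nsmul (fun p q => (D ^ p) f * (D ^ q) g), pow_succ',
      Module.End.mul_apply, ih, map_sum, ← Finset.sum_add_distrib]
    refine Finset.sum_congr rfl fun x hx => ?_
    rw [Finset.HasAntidiagonal.mem_antidiagonal] at hx
    have hch : d.choose x.2 = d.choose x.1 := Nat.choose_symm_of_eq_add (by omega)
    rw [map_nsmul, hD.leibniz, pow_succ', pow_succ', Module.End.mul_apply, Module.End.mul_apply,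
      hch, smul_add, add_comm]

theorem IsDer.expEnd_mul [CharZero k] {D : Module.End k (Ass k n)} (hD : IsDer D)
    (hr : Raises 1 D) (f g : Ass k n) : expEnd D (f * g) = expEnd D f * expEnd D g := by
  have h1 := map_seriesSum (raises_mulRight (r := 0) (mem_Fil_zero (expEnd D g)))
    (pow_term_mem_zero hr f fun d => (d.factorial : k)⁻¹)
  have h2 : ∀ p : ℕ, ((p.factorial : k)⁻¹ • (D ^ p) f) * expEnd D g = seriesSum fun q =>
      ((p.factorial : k)⁻¹ • (D ^ p) f) * ((q.factorial : k)⁻¹ • (D ^ q) g) := fun p => by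
    rw [expEnd_apply]
    exact map_seriesSum (raises_mulLeft (r := 0) (mem_Fil_zero _))
      (pow_term_mem_zero hr g fun d => (d.factorial : k)⁻¹)
  simp only [LinearMap.mulRight_apply] at h1
  rw [expEnd_apply D f, h1]
  simp only [h2]
  rw [seriesSum_seriesSum fun p q =>
    Fil_mul (pow_term_mem_zero hr f (fun d => (d.factorial : k)⁻¹) p)
      (pow_term_mem_zero hr g (fun d => (d.factorial : k)⁻¹) q), expEnd_apply]
  congr 1
  funext d
  rw [hD.pow_mul, Finset.smul_sum]
  refine Finset.sum_congr rfl fun x hx => ?_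
  rw [Finset.HasAntidiagonal.mem_antidiagonal] at hx
  rw [smul_mul_smul_comm, ← Nat.cast_smul_eq_nsmul k, smul_smul, ← hx, inv_factorial_mul_choose]

theorem IsDer.expEnd_one {D : Module.End k (Ass k n)} (hD : IsDer D) : expEnd D 1 = 1 := by
  rw [expEnd_apply, seriesSum_eq_zero_term]
  · simp
  · intro d hd
    obtain ⟨e, rfl⟩ := Nat.exists_eq_succ_of_ne_zero hd
    rw [pow_succ, Module.End.mul_apply, hD.map_one, map_zero, smul_zero]

/-! ### The completed free Lie algebra -/

theorem homog_apply (d : ℕ) (f : Ass k n) (w : List (Fin n)) :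
    homog d f w = if w.length = d then f w else 0 := rfl

theorem homog_mul (d : ℕ) (f g : Ass k n) :
    homog d (f * g) = ∑ a ∈ Finset.range (d + 1), homog a f * homog (d - a) g := by
  ext w
  rw [homog_apply, Ass.sum_apply]
  split_ifs with hw
  · rw [Ass.mul_apply, hw]
    refine Finset.sum_congr rfl fun a ha => ?_
    rw [Finset.mem_range] at ha
    rw [Ass.mul_apply, Finset.sum_eq_single a]
    · rw [homog_apply, homog_apply, if_pos, if_pos]
      · rw [List.length_drop, hw]
      · rw [List.length_take]
        omega
    · intro b hb hba
      rw [Finset.mem_range] at hb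
      rw [homog_apply a, if_neg, zero_mul]
      rw [List.length_take]
      omega
    · intro h
      rw [Finset.mem_range] at h
      omega
  · symm
    refine Finset.sum_eq_zero fun a ha => ?_
    rw [Finset.mem_range] at ha
    rw [Ass.mul_apply]
    refine Finset.sum_eq_zero fun b hb => ?_
    rw [Finset.mem_range] at hb
    rw [homog_apply, homog_apply]
    by_cases h1 : (w.take b).length = a
    · rw [if_neg (c := (w.drop b).length = d - a), mul_zero]
      rw [List.length_take] at h1
      rw [List.length_drop]
      omega
    · rw [if_neg h1, zero_mul]

theorem mem_lie {f : Ass k n} : f ∈ lie k n ↔ ∀ d, homog d f ∈ liePoly k n := by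
  simp [lie]

section

attribute [local instance 100] LieRing.ofAssociativeRing

theorem ad_mem_liePoly {f g : Ass k n} (hf : f ∈ liePoly k n) (hg : g ∈ liePoly k n) :
    ad f g ∈ liePoly k n := (liePoly k n).lie_mem hf hg

theorem X_mem_liePoly (i : Fin n) : X i ∈ liePoly k n :=
  LieSubalgebra.subset_lieSpan ⟨i, rfl⟩

theorem liePoly_le {V : Submodule k (Ass k n)} (hX : ∀ i, X i ∈ V)
    (had : ∀ f ∈ V, ∀ g ∈ V, ad f g ∈ V) {f : Ass k n} (hf : f ∈ liePoly k n) : f ∈ V := by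
  induction hf using LieSubalgebra.lieSpan_induction with
  | mem x hx => obtain ⟨i, rfl⟩ := hx; exact hX i
  | zero => exact zero_mem _
  | smul c x _ h => exact Submodule.smul_mem _ c h
  | add x y _ _ hx hy => exact add_mem hx hy
  | lie x y _ _ hx hy => exact had x hx y hy

theorem sum_mem_liePoly {ι : Type*} (s : Finset ι) {f : ι → Ass k n}
    (h : ∀ i ∈ s, f i ∈ liePoly k n) : ∑ i ∈ s, f i ∈ liePoly k n :=
  (liePoly k n).toSubmodule.sum_mem h

end

theorem ad_mem_lie {f g : Ass k n} (hf : f ∈ lie k n) (hg : g ∈ lie k n) : ad f g ∈ lie k n := by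
  rw [mem_lie] at *
  intro d
  -- Reversing the second sum pairs the components of degrees a and d - a into brackets.
  rw [ad_apply, map_sub, homog_mul, homog_mul, ← Finset.sum_range_reflect (n := d + 1)
    (f := fun a => homog a g * homog (d - a) f), ← Finset.sum_sub_distrib]
  refine sum_mem_liePoly _ fun a ha => ?_
  rw [Finset.mem_range] at ha
  rw [show d + 1 - 1 - a = d - a by omega, show d - (d - a) = a by omega]
  exact ad_mem_liePoly (hf a) (hg (d - a))

theorem X_mem_lie (i : Fin n) : X i ∈ lie k n := by
  rw [mem_lie]
  intro d
  have h : homog d (X i : Ass k n) = if d = 1 then X i else 0 := by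
    ext w
    rw [homog_apply]
    by_cases hw : w = [i]
    · subst hw
      by_cases hd : d = 1
      · simp [hd]
      · simp [hd, Ne.symm hd]
    · have : (X i : Ass k n) w = 0 := by simp [X, hw]
      split_ifs <;> simp [this]
  rw [h]
  split_ifs
  · exact X_mem_liePoly i
  · exact zero_mem _

theorem mem_Fil_one_of_mem_lie {f : Ass k n} (hf : f ∈ lie k n) : f ∈ Fil k n 1 := by
  have h := liePoly_le (V := Fil k n 1) X_mem_Fil
    (fun f _ g hg => Fil_anti (by omega) (raises_ad (mem_Fil_zero f) 1 g hg)) (mem_lie.1 hf 0)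
  rw [mem_Fil_one] at h ⊢
  simpa [homog_apply] using h

theorem seriesSum_mem_lie {c : ℕ → Ass k n} (hc : ∀ d, c d ∈ lie k n) :
    seriesSum c ∈ lie k n := by
  rw [mem_lie]
  intro d
  have h : homog d (seriesSum c) = ∑ e ∈ Finset.range (d + 1), homog d (c e) := by
    ext w
    rw [homog_apply, Ass.sum_apply]
    simp only [homog_apply]
    split_ifs with hw
    · rw [seriesSum_apply, hw]
    · simp
  rw [h]
  exact sum_mem_liePoly _ fun e _ => mem_lie.1 (hc e) d

/-- For Lie polynomials, p and D p are carried together through the induction on brackets. For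
series, the degree d part of D f involves only components of f of degree at most d, as D does not
lower degree. -/
theorem IsDer.map_mem_lie {D : Module.End k (Ass k n)} (hD : IsDer D)
    (hX : ∀ i, D (X i) ∈ lie k n) {f : Ass k n} (hf : f ∈ lie k n) : D f ∈ lie k n := by
  have hpoly : ∀ p ∈ liePoly k n, p ∈ lie k n ⊓ (lie k n).comap D := by
    intro p hp
    refine liePoly_le (V := lie k n ⊓ (lie k n).comap D)
      (fun i => Submodule.mem_inf.2 ⟨X_mem_lie i, hX i⟩) ?_ hp
    rintro p ⟨hp, hDp⟩ q ⟨hq, hDq⟩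
    refine ⟨ad_mem_lie hp hq, ?_⟩
    have h : D (ad p q) = ad (D p) q + ad p (D q) := by
      simp only [ad_apply, map_sub, hD.leibniz]
      noncomm_ring
    change D (ad p q) ∈ lie k n
    rw [h]
    exact add_mem (ad_mem_lie hDp hq) (ad_mem_lie hp hDq)
  rw [mem_lie]
  intro d
  have h1 : f - ∑ e ∈ Finset.range (d + 1), homog e f ∈ Fil k n (d + 1) := by
    intro w hw
    rw [Ass.sub_apply, Ass.sum_apply, Finset.sum_eq_single w.length]
    · simp [homog_apply]
    · intro e _ he
      rw [homog_apply, if_neg (Ne.symm he)]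
    · simp [hw]
  have h2 : homog d (D f) = ∑ e ∈ Finset.range (d + 1), homog d (D (homog e f)) := by
    rw [← map_sum, ← map_sum, ← sub_eq_zero, ← map_sub, ← map_sub]
    ext w
    rw [homog_apply]
    split_ifs with hw
    · exact hD.raises _ _ h1 w (by omega)
    · rfl
  rw [h2]
  exact sum_mem_liePoly _ fun e _ => mem_lie.1 (hpoly _ (mem_lie.1 hf e)).2 d

/-- Cyclic sums kill brackets, and the generators live only in length one. -/
theorem cyc_eq_zero_of_mem_lie {f : Ass k n} (hf : f ∈ lie k n) {w : List (Fin n)}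
    (hw : 2 ≤ w.length) : cyc f w = 0 := by
  have h : ∀ p ∈ liePoly k n, p ∈ LinearMap.ker (coeff w ∘ₗ cyc) := by
    intro p hp
    refine liePoly_le (fun i => ?_) (fun p _ q _ => ?_) hp
    · rw [LinearMap.mem_ker, LinearMap.comp_apply, coeff_apply, cyc_apply]
      refine Finset.sum_eq_zero fun j _ => ?_
      rw [X, Ass.of_apply, if_neg]
      intro hcon
      have := congrArg List.length hcon
      simp only [List.length_rotate, List.length_singleton] at this
      omega
    · rw [LinearMap.mem_ker, LinearMap.comp_apply, cyc_ad, map_zero]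
  have h1 : cyc (homog w.length f) w = 0 := h _ (mem_lie.1 hf _)
  rw [← h1, cyc_apply, cyc_apply]
  refine Finset.sum_congr rfl fun i _ => ?_
  rw [homog_apply, if_pos (List.length_rotate ..)]

/-- A series commuting with `x_i` involves only powers of `x_i`. -/
theorem eq_zero_of_commute_X {i : Fin n} {f : Ass k n} (h : ad (X i) f = 0) {w : List (Fin n)}
    (hw : ∃ j ∈ w, j ≠ i) : f w = 0 := by
  rw [ad_apply, sub_eq_zero] at h
  -- Comparing x_i f with f x_i moves a trailing x_i to the front without changing the coefficient.
  -- Once the last letter differs from x_i, the coefficient is zero.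
  have key : ∀ v : List (Fin n), ∀ p, (∃ j ∈ v, j ≠ i) → f (List.replicate p i ++ v) = 0 := by
    intro v
    induction v using List.reverseRecOn with
    | nil => rintro p ⟨j, hj, _⟩; simp at hj
    | append_singleton v l ih =>
      intro p hex
      have h1 := congrArg (fun g : Ass k n => g (i :: (List.replicate p i ++ v) ++ [l])) h
      simp only [mul_X_append] at h1
      rw [List.cons_append, X_mul_cons, if_pos rfl, List.append_assoc] at h1
      rw [h1]
      split_ifs with hl
      · refine ih (p + 1) ?_
        obtain ⟨j, hj, hne⟩ := hex
        rw [List.mem_append, List.mem_singleton] at hj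
        refine ⟨j, hj.resolve_right fun hjl => hne (hjl.trans hl), hne⟩
      · rfl
  exact key w 0 hw

/-- Only powers of x_i can survive. The constant term is excluded for Lie series, the linear one by
normalisation, and for N ≥ 2 the vanishing cyclic sum is N times the coefficient of x_i^N. -/
theorem eq_zero_of_ad_X_eq_zero [CharZero k] {i : Fin n} {f : Ass k n} (hf : f ∈ lie k n)
    (hi : f [i] = 0) (h : ad (X i) f = 0) : f = 0 := by
  ext w
  by_cases hw : ∃ j ∈ w, j ≠ i
  · exact eq_zero_of_commute_X h hw
  · push Not at hw
    have hr : w = List.replicate w.length i := List.eq_replicate_of_mem hw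
    rcases Nat.lt_or_ge w.length 2 with h2 | h2
    · interval_cases hl : w.length
      · rw [hr]
        exact mem_Fil_one.1 (mem_Fil_one_of_mem_lie hf)
      · rw [hr]
        exact hi
    · have h3 := cyc_eq_zero_of_mem_lie hf h2
      rw [cyc_apply, Finset.sum_congr rfl (g := fun _ => f w), Finset.sum_const,
        Finset.card_range, nsmul_eq_mul, mul_eq_zero] at h3
      · refine h3.resolve_left ?_
        rw [← Ne, Nat.cast_ne_zero]
        omega
      · intro j _
        rw [hr, List.rotate_replicate]

/-! ### Tangential derivations -/

/-- The derivation `x_i ↦ [x_i, a_i]`. -/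
def tangentialDer (a : Fin n → Ass k n) : Module.End k (Ass k n) :=
  derivation fun i => ad (X i) (a i)

theorem raises_tangentialDer {r : ℕ} {a : Fin n → Ass k n} (ha : ∀ i, a i ∈ Fil k n r) :
    Raises r (tangentialDer a) :=
  raises_derivation fun i => raises_ad (X_mem_Fil i) r _ (ha i)

theorem ad_X_mem_Fil (i : Fin n) (a : Ass k n) : ad (X i) a ∈ Fil k n 1 :=
  raises_ad (X_mem_Fil i) 0 _ (mem_Fil_zero a)

theorem isDer_tangentialDer (a : Fin n → Ass k n) : IsDer (tangentialDer a) :=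
  isDer_derivation fun i => ad_X_mem_Fil i _

theorem tangentialDer_X (a : Fin n → Ass k n) (i : Fin n) :
    tangentialDer a (X i) = ad (X i) (a i) := derivation_X (fun i => ad_X_mem_Fil i _) i

theorem tangentialDer_neg (a : Fin n → Ass k n) : tangentialDer (-a) = -tangentialDer a := by
  rw [← neg_one_smul k (tangentialDer a)]
  refine (isDer_tangentialDer _).ext ((isDer_tangentialDer _).smul _) fun i => ?_
  rw [LinearMap.smul_apply, tangentialDer_X, tangentialDer_X, Pi.neg_apply, map_neg, neg_one_smul]

theorem tangentialDer_mem_lie {a : Fin n → Ass k n} (ha : ∀ i, a i ∈ lie k n) {f : Ass k n}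
    (hf : f ∈ lie k n) : tangentialDer a f ∈ lie k n :=
  (isDer_tangentialDer a).map_mem_lie (fun i => by
    rw [tangentialDer_X]
    exact ad_mem_lie (X_mem_lie i) (ha i)) hf

theorem euler_mem_lie {f : Ass k n} (hf : f ∈ lie k n) : euler f ∈ lie k n :=
  isDer_euler.map_mem_lie (fun i => by rw [euler_X]; exact X_mem_lie i) hf

/-- The tuple of the commutator of two tangential derivations. -/
def tangentialBracket (a b : Fin n → Ass k n) (i : Fin n) : Ass k n :=
  ad (a i) (b i) + tangentialDer a (b i) - tangentialDer b (a i)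

theorem tangentialDer_bracket (a b : Fin n → Ass k n) :
    tangentialDer (tangentialBracket a b) =
      tangentialDer a * tangentialDer b - tangentialDer b * tangentialDer a := by
  have ha := isDer_tangentialDer a
  have hb := isDer_tangentialDer b
  refine (isDer_tangentialDer _).ext (ha.commutator hb) fun i => ?_
  simp only [LinearMap.sub_apply, Module.End.mul_apply, tangentialDer_X, tangentialBracket]
  simp only [ad_apply, map_sub, map_add, ha.leibniz, hb.leibniz, tangentialDer_X]
  noncomm_ring

theorem tangentialDer_euler (a : Fin n → Ass k n) :
    tangentialDer (fun i => euler (a i)) = euler * tangentialDer a - tangentialDer a * euler := by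
  have ha := isDer_tangentialDer a
  have hE := isDer_euler (k := k) (n := n)
  refine (isDer_tangentialDer _).ext (hE.commutator ha) fun i => ?_
  simp only [LinearMap.sub_apply, Module.End.mul_apply, tangentialDer_X, euler_X]
  simp only [ad_apply, map_sub, hE.leibniz, euler_X]
  noncomm_ring

theorem mem_dert {a : Fin n → Ass k n} :
    a ∈ dert k n ↔ ∀ i, a i ∈ lie k n ∧ a i [i] = 0 := by
  simp [dert]

theorem tangential_eq (u : dert k n) : tangential u = tangentialDer u.1 := rfl

theorem dert_mem_Fil (u : dert k n) (i : Fin n) : u.1 i ∈ Fil k n 1 :=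
  mem_Fil_one_of_mem_lie (mem_dert.1 u.2 i).1

theorem raises_tangential (u : dert k n) : Raises 1 (tangential u) :=
  raises_tangentialDer (dert_mem_Fil u)

theorem isDer_tangential (u : dert k n) : IsDer (tangential u) := isDer_tangentialDer u.1

theorem tangential_injective [CharZero k] :
    Function.Injective (tangential : dert k n → Module.End k (Ass k n)) := by
  intro u v h
  ext i : 2
  have hu := mem_dert.1 u.2 i
  have hv := mem_dert.1 v.2 i
  refine sub_eq_zero.1 (eq_zero_of_ad_X_eq_zero (i := i) (sub_mem hu.1 hv.1) ?_ ?_)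
  · rw [Ass.sub_apply, hu.2, hv.2, sub_zero]
  · have := LinearMap.congr_fun h (X i)
    rw [tangential_eq, tangential_eq, tangentialDer_X, tangentialDer_X] at this
    rw [map_sub, this, sub_self]

theorem act_inv (g : Dert k n) : (g⁻¹).act = expEnd (-tangential g.log) := by
  change expEnd (tangentialDer (-g.log.1)) = _
  rw [tangentialDer_neg]
  rfl

/-! ### Existence of the tangential derivation `κ(F)` -/

/-- The tuples of the iterated commutators of `tangentialDer w` applied to `[l, w]`. -/
def adTuple (w : Fin n → Ass k n) : ℕ → Fin n → Ass k n
  | 0 => fun i => euler (w i)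
  | d + 1 => tangentialBracket w (adTuple w d)

/-- Commutation with `W`, as a sum of commuting operators. -/
def adEnd (W : Module.End k (Ass k n)) : Module.End k (Module.End k (Ass k n)) :=
  LinearMap.mulLeft k W + LinearMap.mulRight k (-W)

theorem adEnd_apply (W E : Module.End k (Ass k n)) : adEnd W E = W * E - E * W := by
  simp [adEnd, sub_eq_add_neg]

theorem tangentialDer_adTuple (w : Fin n → Ass k n) (d : ℕ) :
    tangentialDer (adTuple w d) = -(adEnd (tangentialDer w) ^ (d + 1)) euler := by
  induction d with
  | zero =>
    rw [zero_add, pow_one, adEnd_apply, neg_sub]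
    exact tangentialDer_euler w
  | succ d ih =>
    rw [adTuple, tangentialDer_bracket, ← adEnd_apply, ih, pow_succ' _ (d + 1),
      Module.End.mul_apply, map_neg]

theorem adTuple_mem_Fil {w : Fin n → Ass k n} (hw : ∀ i, w i ∈ Fil k n 1) (d : ℕ) (i : Fin n) :
    adTuple w d i ∈ Fil k n (d + 1) := by
  induction d generalizing i with
  | zero => exact isDer_euler.raises _ _ (hw i)
  | succ d ih =>
    refine sub_mem (add_mem ?_ ?_) ?_
    · exact raises_ad (hw i) _ _ (ih i)
    · exact raises_tangentialDer hw _ _ (ih i)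
    · exact Fil_anti (by omega) (raises_tangentialDer ih _ _ (hw i))

theorem adTuple_mem_lie {w : Fin n → Ass k n} (hw : ∀ i, w i ∈ lie k n) (d : ℕ) (i : Fin n) :
    adTuple w d i ∈ lie k n := by
  induction d generalizing i with
  | zero => exact euler_mem_lie (hw i)
  | succ d ih =>
    exact sub_mem (add_mem (ad_mem_lie (hw i) (ih i)) (tangentialDer_mem_lie hw (ih i)))
      (tangentialDer_mem_lie ih (hw i))

theorem adTuple_linear {w : Fin n → Ass k n} (hw : ∀ i, w i ∈ Fil k n 1) (h : ∀ i, w i [i] = 0)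
    (d : ℕ) (i : Fin n) : adTuple w d i [i] = 0 := by
  cases d with
  | zero =>
    change euler (w i) [i] = 0
    rw [euler_apply, h, mul_zero]
  -- After at least one bracket the entries start in degree two or higher, so there is no linear
  -- term.
  | succ d => exact adTuple_mem_Fil hw (d + 1) i [i] (by simp)

/-- The tuple of `κ(exp w)`. -/
def kappaTuple (w : Fin n → Ass k n) (i : Fin n) : Ass k n :=
  seriesSum fun d => ((d + 1).factorial : k)⁻¹ • adTuple w d i

theorem kappaTuple_mem (w : dert k n) : kappaTuple w.1 ∈ dert k n := by
  refine mem_dert.2 fun i => ⟨seriesSum_mem_lie fun d => Submodule.smul_mem _ _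
    (adTuple_mem_lie (fun i => (mem_dert.1 w.2 i).1) d i), ?_⟩
  rw [kappaTuple, seriesSum_apply]
  refine Finset.sum_eq_zero fun d _ => ?_
  rw [Ass.smul_apply, adTuple_linear (dert_mem_Fil w) (fun i => (mem_dert.1 w.2 i).2), mul_zero]

theorem adTuple_term_mem {w : Fin n → Ass k n} (hw : ∀ i, w i ∈ Fil k n 1) (i : Fin n) (d : ℕ) :
    ((d + 1).factorial : k)⁻¹ • adTuple w d i ∈ Fil k n d :=
  Submodule.smul_mem _ _ (Fil_anti (Nat.le_succ d) (adTuple_mem_Fil hw d i))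

/-- The series on the right is itself a continuous derivation, so it suffices to compare on
generators, where the claim is continuity of ad. -/
theorem tangentialDer_kappaTuple {w : Fin n → Ass k n} (hw : ∀ i, w i ∈ Fil k n 1)
    (f : Ass k n) : tangentialDer (kappaTuple w) f =
      seriesSum fun d => ((d + 1).factorial : k)⁻¹ • tangentialDer (adTuple w d) f := by
  let S : Module.End k (Ass k n) := seriesSum ∘ₗ LinearMap.pi fun d =>
    ((d + 1).factorial : k)⁻¹ • tangentialDer (adTuple w d)
  have hS : ∀ f, S f = seriesSum fun d =>
      ((d + 1).factorial : k)⁻¹ • tangentialDer (adTuple w d) f := fun _ => rfl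
  have hr : ∀ d, Raises d (tangentialDer (adTuple w d)) := fun d =>
    (raises_tangentialDer (adTuple_mem_Fil hw d)).mono (Nat.le_succ d)
  have hmem : ∀ f d, ((d + 1).factorial : k)⁻¹ • tangentialDer (adTuple w d) f ∈ Fil k n d :=
    fun f d => Submodule.smul_mem _ _ (by simpa using hr d 0 f (mem_Fil_zero f))
  have hder : IsDer S := by
    refine ⟨fun N f hf => ?_, fun f g => ?_⟩
    · rw [hS]
      exact seriesSum_mem_Fil fun d => Submodule.smul_mem _ _ ((hr d).zero' N f hf)
    · have h1 := map_seriesSum (raises_mulRight (r := 0) (mem_Fil_zero g)) (hmem f)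
      have h2 := map_seriesSum (raises_mulLeft (r := 0) (mem_Fil_zero f)) (hmem g)
      simp only [LinearMap.mulLeft_apply, LinearMap.mulRight_apply] at h1 h2
      rw [hS, hS, hS, h1, h2, ← map_add]
      congr 1
      funext d
      rw [(isDer_tangentialDer _).leibniz, smul_add, Pi.add_apply, smul_mul_assoc, mul_smul_comm]
  rw [← hS]
  congr 1
  refine (isDer_tangentialDer _).ext hder fun i => ?_
  have h1 := map_seriesSum (raises_ad (r := 0) (mem_Fil_zero (X i))) (adTuple_term_mem hw i)
  rw [tangentialDer_X, hS, kappaTuple, h1]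
  simp only [tangentialDer_X, map_smul]

/-- The identity e^W E e^{-W} = e^{ad W} E: commutation with W is left multiplication by W plus
right multiplication by -W, which commute. -/
theorem expEnd_conj [CharZero k] {W E : Module.End k (Ass k n)} (hW : Raises 1 W)
    (hE : Raises 0 E) (f : Ass k n) : expEnd W (E (expEnd (-W) f)) =
      seriesSum fun d => (d.factorial : k)⁻¹ • ((adEnd W ^ d) E) f := by
  have h1 := double_series hW hE hW.neg (fun p => (p.factorial : k)⁻¹)
    (fun q => (q.factorial : k)⁻¹) f
  rw [expEnd_apply W, expEnd_apply (-W), h1]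
  congr 1
  funext d
  have h2 := congrArg (fun T : Module.End k (Module.End k (Ass k n)) => T E f)
    (sum_antidiagonal_inv_factorial (k := k) (LinearMap.commute_mulLeft_right (R := k) W (-W)) d)
  simp only [LinearMap.sum_apply, LinearMap.smul_apply, Module.End.mul_apply,
    LinearMap.pow_mulLeft, LinearMap.pow_mulRight, LinearMap.mulLeft_apply,
    LinearMap.mulRight_apply] at h2
  rw [adEnd, ← h2]
  simp only [LinearMap.sum_apply, LinearMap.smul_apply, Module.End.mul_apply]

theorem raises_adEnd_pow {W E : Module.End k (Ass k n)} (hW : Raises 1 W) (hE : Raises 0 E)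
    (d : ℕ) : Raises d ((adEnd W ^ d) E) := by
  induction d with
  | zero => exact hE
  | succ d ih =>
    rw [pow_succ', Module.End.mul_apply, adEnd_apply]
    exact (hW.mul ih).sub (by rw [add_comm]; exact ih.mul hW)

/-- The d = 0 term of e^{ad W} l cancels l, and the index shift in the rest produces the
coefficients 1/(d+1)!. -/
theorem tangential_kappaTuple [CharZero k] (F : Dert k n) :
    tangential ⟨kappaTuple F.log.1, kappaTuple_mem F.log⟩ = kappa F := by
  ext1 f
  have hW := raises_tangential F.log
  have hE := (isDer_euler (k := k) (n := n)).raises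
  rw [tangential_eq, tangentialDer_kappaTuple (dert_mem_Fil F.log), kappa, act_inv, Dert.act,
    LinearMap.sub_apply, Module.End.mul_apply, Module.End.mul_apply, expEnd_conj hW hE,
    seriesSum_succ (c := fun d => (d.factorial : k)⁻¹ • ((adEnd (tangential F.log) ^ d) euler) f)]
  · simp only [Nat.factorial_zero, Nat.cast_one, inv_one, pow_zero, one_smul,
      Module.End.one_apply, sub_add_cancel_left, tangentialDer_adTuple, LinearMap.neg_apply,
      smul_neg]
    exact map_neg (seriesSum (k := k)) _
  · exact fun d => Submodule.smul_mem _ _ (by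
      simpa using raises_adEnd_pow hW hE d 0 f (mem_Fil_zero f))

theorem existsUnique_tangential_eq_kappa [CharZero k] (F : Dert k n) :
    ∃! u : dert k n, tangential u = kappa F :=
  ⟨_, tangential_kappaTuple F, fun _ hv =>
    tangential_injective (hv.trans (tangential_kappaTuple F).symm)⟩

/-! ### The divergence -/

theorem partialDer_mul_X (i j : Fin n) (f : Ass k n) :
    partialDer i (f * X j) = if i = j then f else 0 := by
  ext w
  change (f * X j : Ass k n) (w ++ [i]) = _
  rw [mul_X_append]
  split_ifs <;> rfl

theorem eq_sum_partialDer_mul_X {f : Ass k n} (hf : f ∈ Fil k n 1) :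
    f = ∑ i, partialDer i f * X i := by
  ext w
  rw [Ass.sum_apply]
  by_cases hw : w = []
  · subst hw
    simp [mul_X_nil, mem_Fil_one.1 hf]
  · obtain ⟨v, j, rfl⟩ := List.eq_nil_or_concat' w |>.resolve_left hw
    simp only [mul_X_append, Finset.sum_ite_eq, Finset.mem_univ, if_true]
    rfl

theorem partialDer_mul (i : Fin n) (f : Ass k n) {g : Ass k n} (hg : g ∈ Fil k n 1) :
    partialDer i (f * g) = f * partialDer i g := by
  conv_lhs => rw [eq_sum_partialDer_mul_X hg, Finset.mul_sum, map_sum]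
  simp [← mul_assoc, partialDer_mul_X]

theorem raises_X_mul_partialDer (i : Fin n) :
    Raises 0 (LinearMap.mulLeft k (X i) ∘ₗ partialDer i) := fun N f hf => by
  rw [LinearMap.comp_apply, LinearMap.mulLeft_apply]
  intro w hw
  cases w with
  | nil => exact X_mul_nil _ _
  | cons j v =>
    rw [X_mul_cons]
    split_ifs
    · exact hf (v ++ [i]) (by simpa using hw)
    · rfl

/-- The representative `∑ x_i ∂_i a_i` of the divergence of a tuple of series. -/
def divTuple (a : Fin n → Ass k n) : Ass k n := ∑ i, X i * partialDer i (a i)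

/-- Chain rule obtained by writing b = ∑ (∂_j b) x_j and applying Leibniz: the last letter lies
either in x_j itself or in a_j. -/
theorem partialDer_tangentialDer (a : Fin n → Ass k n) (ha : ∀ i, a i ∈ Fil k n 1) {b : Ass k n}
    (hb : b ∈ Fil k n 1) (i : Fin n) : partialDer i (tangentialDer a b) =
      tangentialDer a (partialDer i b) - partialDer i b * a i +
        ∑ j, partialDer j b * (X j * partialDer i (a j)) := by
  have hD := isDer_tangentialDer a
  conv_lhs => rw [eq_sum_partialDer_mul_X hb, map_sum, map_sum]
  have h : ∀ j, partialDer i (tangentialDer a (partialDer j b * X j)) =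
      (if i = j then tangentialDer a (partialDer j b) - partialDer j b * a j else 0) +
        partialDer j b * (X j * partialDer i (a j)) := by
    intro j
    rw [hD.leibniz, tangentialDer_X, ad_apply, mul_sub, ← mul_assoc _ (a j), map_add, map_sub,
      partialDer_mul_X, partialDer_mul_X, ← mul_assoc, partialDer_mul i _ (ha j), mul_assoc]
    split_ifs
    · abel
    · abel
  simp only [h, Finset.sum_add_distrib]
  simp

/-- The divergence is a 1-cocycle. -/
theorem cyc_divTuple_bracket {a b : Fin n → Ass k n} (ha : ∀ i, a i ∈ Fil k n 1)
    (hb : ∀ i, b i ∈ Fil k n 1) : cyc (divTuple (tangentialBracket a b)) =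
      cyc (tangentialDer a (divTuple b) - tangentialDer b (divTuple a)) := by
  -- Modulo commutators, ∑ x_i ∂_i(a·b_i) is a·div b, corrected by a term that cancels against the
  -- bracket [a_i, b_i] and a double sum symmetric in a and b. The discrepancy is the commutator
  -- [a_i, x_i ∂_i b_i].
  have key : ∀ a b : Fin n → Ass k n, (∀ i, a i ∈ Fil k n 1) → (∀ i, b i ∈ Fil k n 1) →
      cyc (∑ i, X i * partialDer i (tangentialDer a (b i))) =
        cyc (tangentialDer a (divTuple b)) - cyc (∑ i, X i * (a i * partialDer i (b i))) +
        cyc (∑ i, ∑ j, X i * partialDer j (b i) * (X j * partialDer i (a j))) := by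
    intro a b ha hb
    rw [divTuple]
    simp only [map_sum]
    rw [← Finset.sum_sub_distrib, ← Finset.sum_add_distrib]
    refine Finset.sum_congr rfl fun i _ => ?_
    rw [partialDer_tangentialDer a ha (hb i), (isDer_tangentialDer a).leibniz, tangentialDer_X,
      ← map_sum, ← map_sub, ← map_add, ← sub_eq_zero, ← map_sub]
    rw [show X i * (tangentialDer a (partialDer i (b i)) - partialDer i (b i) * a i +
        ∑ j, partialDer j (b i) * (X j * partialDer i (a j))) -
        (ad (X i) (a i) * partialDer i (b i) + X i * tangentialDer a (partialDer i (b i)) -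
          X i * (a i * partialDer i (b i)) +
          ∑ j, X i * partialDer j (b i) * (X j * partialDer i (a j))) =
        ad (a i) (X i * partialDer i (b i)) by
      simp only [mul_add, mul_sub, Finset.mul_sum, ad_apply, sub_mul, mul_assoc]
      abel]
    exact cyc_ad _ _
  have hsym : cyc (∑ i, ∑ j, X i * partialDer j (b i) * (X j * partialDer i (a j))) =
      cyc (∑ i, ∑ j, X i * partialDer j (a i) * (X j * partialDer i (b j))) := by
    rw [Finset.sum_comm]
    simp only [map_sum]
    exact Finset.sum_congr rfl fun i _ => Finset.sum_congr rfl fun j _ => cyc_mul_comm _ _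
  have had : ∑ i, X i * partialDer i (ad (a i) (b i)) =
      ∑ i, X i * (a i * partialDer i (b i)) - ∑ i, X i * (b i * partialDer i (a i)) := by
    rw [← Finset.sum_sub_distrib]
    refine Finset.sum_congr rfl fun i _ => ?_
    rw [ad_apply, map_sub, partialDer_mul i _ (hb i), partialDer_mul i _ (ha i), mul_sub]
  have hsplit : divTuple (tangentialBracket a b) =
      ∑ i, X i * partialDer i (ad (a i) (b i)) +
        ∑ i, X i * partialDer i (tangentialDer a (b i)) -
        ∑ i, X i * partialDer i (tangentialDer b (a i)) := by
    rw [← Finset.sum_add_distrib, ← Finset.sum_sub_distrib]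
    exact Finset.sum_congr rfl fun i _ => by
      rw [tangentialBracket, map_sub, map_add, mul_sub, mul_add]
  rw [hsplit, had, map_sub, map_add, key a b ha hb, key b a hb ha, hsym, map_sub, map_sub]
  abel

/-- x_i ∂_i moves the last letter x_i to the front and so preserves word length. -/
theorem divTuple_euler (a : Fin n → Ass k n) :
    divTuple (fun i => euler (a i)) = euler (divTuple a) := by
  rw [divTuple, divTuple, map_sum]
  refine Finset.sum_congr rfl fun i _ => ?_
  ext w
  rw [euler_apply]
  cases w with
  | nil => rw [X_mul_nil, X_mul_nil, mul_zero]
  | cons j v =>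
    rw [X_mul_cons, X_mul_cons]
    split_ifs
    · change euler (a i) (v ++ [i]) = _ * a i (v ++ [i])
      rw [euler_apply]
      simp
    · simp

/-- The operators `∑_{p + q = d} (d + 1 choose p) W^p E (-W)^q`. -/
def chooseEnd (W E : Module.End k (Ass k n)) (d : ℕ) : Module.End k (Ass k n) :=
  ∑ x ∈ Finset.HasAntidiagonal.antidiagonal d,
    (d + 1).choose x.1 • (W ^ x.1 * E * (-W) ^ x.2)

theorem adEnd_pow_apply (W E : Module.End k (Ass k n)) (d : ℕ) :
    (adEnd W ^ d) E = ∑ x ∈ Finset.HasAntidiagonal.antidiagonal d,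
      d.choose x.1 • (W ^ x.1 * E * (-W) ^ x.2) := by
  rw [adEnd, (LinearMap.commute_mulLeft_right (R := k) W (-W)).add_pow', LinearMap.sum_apply]
  refine Finset.sum_congr rfl fun x _ => ?_
  rw [LinearMap.smul_apply, Module.End.mul_apply, LinearMap.pow_mulLeft, LinearMap.pow_mulRight,
    LinearMap.mulLeft_apply, LinearMap.mulRight_apply, mul_assoc]

/-- Pascal's rule for the binomial coefficients of d + 2. -/
theorem chooseEnd_succ (W E : Module.End k (Ass k n)) (d : ℕ) :
    chooseEnd W E (d + 1) = W * chooseEnd W E d + (adEnd W ^ (d + 1)) E := by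
  rw [chooseEnd, chooseEnd, adEnd_pow_apply, Finset.Nat.sum_antidiagonal_succ,
    Finset.Nat.sum_antidiagonal_succ, Finset.mul_sum, add_left_comm, ← Finset.sum_add_distrib]
  congr 1
  refine Finset.sum_congr rfl fun x _ => ?_
  rw [Nat.choose_succ_succ (d + 1) x.1, add_smul, mul_smul_comm, pow_succ' W, mul_assoc W,
    mul_assoc W]

/-- The cocycle rule for the bracket of w with the d-th tuple gives W applied to the previous
divergence plus ad_W^{d+1}(l) applied to div w. This is the recursion of `chooseEnd`, with initial
value l(div w). -/
theorem cyc_divTuple_adTuple [CharZero k] {w : Fin n → Ass k n} (hw : ∀ i, w i ∈ Fil k n 1)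
    (d : ℕ) : cyc (divTuple (adTuple w d)) =
      cyc (chooseEnd (tangentialDer w) euler d (divTuple w)) := by
  induction d with
  | zero =>
    rw [adTuple, divTuple_euler]
    simp [chooseEnd]
  | succ d ih =>
    have hmem := fun i => Fil_anti (Nat.le_add_left 1 d) (adTuple_mem_Fil hw d i)
    rw [adTuple, cyc_divTuple_bracket hw hmem, tangentialDer_adTuple, chooseEnd_succ,
      LinearMap.neg_apply, sub_neg_eq_add, LinearMap.add_apply, map_add, map_add,
      Module.End.mul_apply]
    congr 1
    rw [← sub_eq_zero, ← map_sub, ← map_sub]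
    refine (isDer_tangentialDer w).cyc_eq_zero ?_
    rw [map_sub, ih, sub_self]

theorem inv_factorial_smul_chooseEnd [CharZero k] (W E : Module.End k (Ass k n)) (d : ℕ) :
    ((d + 1).factorial : k)⁻¹ • chooseEnd W E d =
      ∑ x ∈ Finset.HasAntidiagonal.antidiagonal d,
        ((x.1.factorial : k)⁻¹ * ((x.2 + 1).factorial : k)⁻¹) • (W ^ x.1 * E * (-W) ^ x.2) := by
  rw [chooseEnd, Finset.smul_sum]
  refine Finset.sum_congr rfl fun x hx => ?_
  rw [Finset.HasAntidiagonal.mem_antidiagonal] at hx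
  rw [← Nat.cast_smul_eq_nsmul k, smul_smul, ← hx, add_assoc, inv_factorial_mul_choose]

/-- Dividing by (d+1)! splits the coefficients of `chooseEnd` into 1/p! and 1/(q+1)!, so the sum
over d factors as e^W · l · (1 - e^{-W})/W. -/
theorem cyc_divTuple_kappaTuple [CharZero k] {w : Fin n → Ass k n}
    (hw : ∀ i, w i ∈ Fil k n 1) : cyc (divTuple (kappaTuple w)) =
      cyc (expEnd (tangentialDer w) (euler (expSubOneDiv (-tangentialDer w) (divTuple w)))) := by
  have hW := raises_tangentialDer hw
  have hE := (isDer_euler (k := k) (n := n)).raises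
  have h1 := double_series hW hE hW.neg (fun p => (p.factorial : k)⁻¹)
    (fun q => ((q + 1).factorial : k)⁻¹) (divTuple w)
  have h2 : divTuple (kappaTuple w) =
      seriesSum fun d => ((d + 1).factorial : k)⁻¹ • divTuple (adTuple w d) := by
    have h3 : ∀ i, X i * partialDer i (kappaTuple w i) = seriesSum fun d =>
        ((d + 1).factorial : k)⁻¹ • (X i * partialDer i (adTuple w d i)) := by
      intro i
      have := map_seriesSum (raises_X_mul_partialDer i) (adTuple_term_mem hw i)
      simp only [LinearMap.comp_apply, LinearMap.mulLeft_apply, map_smul] at this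
      exact this
    rw [divTuple]
    simp only [h3]
    rw [← map_sum]
    congr 1
    funext d
    rw [divTuple, Finset.smul_sum, Finset.sum_apply]
  have h4 : ∀ d, ((d + 1).factorial : k)⁻¹ • divTuple (adTuple w d) ∈ Fil k n d := fun d =>
    Submodule.smul_mem _ _ (sum_mem fun i _ => raises_X_mul_partialDer i _ _
      (Fil_anti (Nat.le_succ d) (adTuple_mem_Fil hw d i)))
  have h5 : ∀ d, (((d + 1).factorial : k)⁻¹ • chooseEnd (tangentialDer w) euler d)
      (divTuple w) ∈ Fil k n d := fun d => by
    rw [LinearMap.smul_apply, chooseEnd, LinearMap.sum_apply]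
    refine Submodule.smul_mem _ _ (sum_mem fun x hx => ?_)
    rw [Finset.HasAntidiagonal.mem_antidiagonal] at hx
    have := ((hW.pow x.1).mul hE).mul (hW.neg.pow x.2) 0 _ (mem_Fil_zero (divTuple w))
    rw [← Nat.cast_smul_eq_nsmul k]
    exact Submodule.smul_mem _ _ (Fil_anti (by omega) this)
  rw [expEnd_apply, expSubOneDiv_apply, h1]
  simp only [← inv_factorial_smul_chooseEnd]
  rw [h2, map_seriesSum raises_cyc h4, map_seriesSum raises_cyc h5]
  congr 1
  funext d
  rw [map_smul, cyc_divTuple_adTuple hw, LinearMap.smul_apply, map_smul]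

/-- This is e^{-W}(e^W - 1)/W = (1 - e^{-W})/W; it identifies F⁻¹·j(F) inside the formula for the
divergence of κ(F). -/
theorem expEnd_neg_expSubOneDiv [CharZero k] {W : Module.End k (Ass k n)} (hW : Raises 1 W)
    (f : Ass k n) : expEnd (-W) (expSubOneDiv W f) = expSubOneDiv (-W) f := by
  have h1 := double_series hW.neg raises_one hW (fun p => (p.factorial : k)⁻¹)
    (fun q => ((q + 1).factorial : k)⁻¹) f
  simp only [Module.End.one_apply, mul_one] at h1
  rw [expEnd_apply, expSubOneDiv_apply, expSubOneDiv_apply, h1]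
  congr 1
  funext d
  have hc : ∑ x ∈ Finset.HasAntidiagonal.antidiagonal d,
      ((x.1.factorial : k)⁻¹ * ((x.2 + 1).factorial : k)⁻¹) * (-1) ^ x.1 =
      ((d + 1).factorial : k)⁻¹ * (-1) ^ d := by
    -- The binomial expansion of (-1 + 1)^{d+1} = 0; splitting off the term with second index 0
    -- leaves the required sum.
    have h := sum_antidiagonal_inv_factorial (k := k) (Commute.all (-1 : k) 1) (d + 1)
    rw [Finset.Nat.sum_antidiagonal_succ'] at h
    simp only [neg_add_cancel, one_pow, mul_one, smul_eq_mul, Nat.factorial_zero, Nat.cast_one,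
      inv_one, ne_eq, Nat.succ_ne_zero, not_false_eq_true, zero_pow, mul_zero] at h
    rw [eq_neg_of_add_eq_zero_right h, pow_succ]
    ring
  rw [← LinearMap.smul_apply]
  congr 1
  have hpow : ∀ p, (-W) ^ p = (-1 : k) ^ p • W ^ p := fun p => by
    rw [← neg_one_smul k W, smul_pow]
  rw [hpow d, smul_smul, ← hc, Finset.sum_smul]
  refine Finset.sum_congr rfl fun x hx => ?_
  rw [Finset.HasAntidiagonal.mem_antidiagonal] at hx
  rw [hpow, smul_mul_assoc, ← pow_add, hx, smul_smul]

/-! ### The Campbell-Hausdorff series -/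

theorem expA_sub_one_mem {a : Ass k n} (ha : a ∈ Fil k n 1) : expA a - 1 ∈ Fil k n 1 := by
  have h : expA a - 1 = expA a - (1 + a) + a := by abel
  rw [h]
  exact add_mem (Fil_anti (by omega) (expA_sub_mem_Fil_two ha)) ha

theorem expA_mul_expA_sub_mem {a b : Ass k n} (ha : a ∈ Fil k n 1) (hb : b ∈ Fil k n 1) :
    expA a * expA b - 1 - (a + b) ∈ Fil k n 2 := by
  have h : expA a * expA b - 1 - (a + b) = (expA a - 1) * (expA b - 1) +
      (expA a - (1 + a)) + (expA b - (1 + b)) := by noncomm_ring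
  rw [h]
  exact add_mem (add_mem (Fil_mul (expA_sub_one_mem ha) (expA_sub_one_mem hb))
    (expA_sub_mem_Fil_two ha)) (expA_sub_mem_Fil_two hb)

theorem expA_mul_expA_sub_one_mem {a b : Ass k n} (ha : a ∈ Fil k n 1) (hb : b ∈ Fil k n 1) :
    expA a * expA b - 1 ∈ Fil k n 1 := by
  have h := add_mem (Fil_anti (by omega) (expA_mul_expA_sub_mem ha hb)) (add_mem ha hb)
  rwa [sub_add_cancel] at h

theorem ch_mem_Fil {a b : Ass k n} (ha : a ∈ Fil k n 1) (hb : b ∈ Fil k n 1) :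
    ch a b ∈ Fil k n 1 := logA_mem_Fil (expA_mul_expA_sub_one_mem ha hb)

theorem ch_sub_mem_Fil_two {a b : Ass k n} (ha : a ∈ Fil k n 1) (hb : b ∈ Fil k n 1) :
    ch a b - (a + b) ∈ Fil k n 2 := by
  have h := add_mem (logA_sub_mem_Fil_two (expA_mul_expA_sub_one_mem ha hb))
    (expA_mul_expA_sub_mem ha hb)
  rwa [sub_add_sub_cancel] at h

/-- e^b e^a = e^{-a}(e^a e^b)e^a, and the logarithm commutes with conjugation. -/
theorem ch_swap [CharZero k] {a b : Ass k n} (ha : a ∈ Fil k n 1) (hb : b ∈ Fil k n 1) :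
    ch b a = expA (-a) * ch a b * expA a := by
  rw [ch, ch, ← logA_conj (expA_mul_expA_sub_one_mem ha hb) (expA_neg_mul ha) (expA_mul_neg ha),
    ← mul_assoc, expA_neg_mul ha, one_mul]

/-- The derivation D + ad_a kills z, hence also e^z. -/
theorem IsDer.map_expA_of_inner [CharZero k] {D : Module.End k (Ass k n)} (hD : IsDer D)
    {z a : Ass k n} (hz : z ∈ Fil k n 1) (h : D z = ad z a) :
    D (expA z) = ad (expA z) a := by
  have h1 := (hD.add (isDer_ad a)).map_expA hz (by
    rw [LinearMap.add_apply, h, ad_apply, ad_apply, sub_add_sub_cancel, sub_self]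
    exact Commute.zero_right z)
  rw [LinearMap.add_apply, LinearMap.add_apply, h] at h1
  simp only [ad_apply, sub_add_sub_cancel, sub_self, mul_zero] at h1 ⊢
  rw [eq_neg_of_add_eq_zero_left h1, neg_sub]

/-- A derivation multiplies `ln g` by `-1` exactly if it multiplies `g` by `-ln g`. -/
theorem IsDer.map_logA_eq_neg_iff [CharZero k] {D : Module.End k (Ass k n)} (hD : IsDer D)
    {g u : Ass k n} (hg : g - 1 ∈ Fil k n 1) (hu : u * g = 1) :
    D (logA g) = -logA g ↔ D g = -(logA g * g) := by
  have hcg : Commute g (logA g) := commute_logA hg (Commute.refl g)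
  constructor
  · intro h
    have h1 := hD.map_expA (logA_mem_Fil hg) (by rw [h]; exact (Commute.refl _).neg_right)
    rwa [expA_logA hg, h, mul_neg, hcg.eq] at h1
  · intro h
    have h1 := hD.mul_map_logA hg (by rw [h]; exact (hcg.mul_right (Commute.refl g)).neg_right)
    rw [h, ← hcg.eq, ← mul_neg] at h1
    calc D (logA g) = u * (g * D (logA g)) := by rw [← mul_assoc, hu, one_mul]
      _ = -logA g := by rw [h1, ← mul_assoc, hu, one_mul]

theorem originalKVEquation_iff [CharZero k] (u : Fin 2 → Ass k 2) :
    OriginalKVEquation (u 0) (u 1) ↔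
      (tangentialDer u - euler : Module.End k (Ass k 2)) (ch (X 0) (X 1)) = -ch (X 0) (X 1) := by
  set D := tangentialDer u - euler
  have hD : IsDer D := (isDer_tangentialDer u).sub isDer_euler
  set x : Ass k 2 := X 0
  set y : Ass k 2 := X 1
  have hx : x ∈ Fil k 2 1 := X_mem_Fil 0
  have hy : y ∈ Fil k 2 1 := X_mem_Fil 1
  have hxx := expA_neg_mul hx
  have hxx' := expA_mul_neg hx
  have hyy := expA_neg_mul hy
  have hyy' := expA_mul_neg hy
  have hg := expA_mul_expA_sub_one_mem hx hy
  have hDexp : ∀ i, D (expA (X i)) = ad (expA (X i)) (u i) - expA (X i) * X i := fun i => by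
    change tangentialDer u (expA (X i)) - euler (expA (X i)) = _
    rw [(isDer_tangentialDer u).map_expA_of_inner (X_mem_Fil i) (tangentialDer_X u i),
      isDer_euler.map_expA (X_mem_Fil i) (by rw [euler_X]), euler_X]
  have hDg : D (expA x * expA y) =
      (ad (expA x) (u 0) - expA x * x) * expA y + expA x * (ad (expA y) (u 1) - expA y * y) := by
    rw [hD.leibniz, hDexp, hDexp]
  have hyexp : expA y * y = y * expA y :=
    (commute_seriesSum (expA_term_mem hy) fun d =>
      ((Commute.refl y).pow_right d).smul_right _).eq.symm
  have hsw := ch_swap hx hy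
  have hiff := hD.map_logA_eq_neg_iff hg (u := expA (-y) * expA (-x)) (by
    rw [mul_assoc, ← mul_assoc (expA (-x)), hxx, one_mul, hyy])
  change _ ↔ D (logA (expA x * expA y)) = -logA (expA x * expA y)
  rw [hiff, hDg]
  have hneg : expEnd (-ad x) = expEnd (ad (-x)) := by
    congr 1
    ext f
    simp [ad_apply]
    abel
  change x + y - ch y x = (1 - expEnd (-ad x)) (u 0) + (expEnd (ad y) - 1) (u 1) ↔ _
  rw [hneg]
  simp only [LinearMap.sub_apply, Module.End.one_apply, expEnd_ad (neg_mem hx), expEnd_ad hy,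
    neg_neg]
  change x + y - ch y x = _ ↔ _ = -(ch x y * (expA x * expA y))
  rw [hsw]
  generalize ch x y = c at *
  -- The equation D(g) = -ch(x,y) g, for g = e^x e^y, is multiplied by e^{-x} on the left and e^{-y}
  -- on the right. Its right side becomes -ch(y,x) by `ch_swap`.
  have e1 : expA (-x) * ((ad (expA x) (u 0) - expA x * x) * expA y +
      expA x * (ad (expA y) (u 1) - expA y * y)) * expA (-y) =
      u 0 - expA (-x) * u 0 * expA x + (expA y * u 1 * expA (-y) - u 1) - (x + y) := by
    rw [hyexp]
    simp only [ad_apply]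
    calc _ = (expA (-x) * expA x) * u 0 * (expA y * expA (-y))
          - expA (-x) * u 0 * expA x * (expA y * expA (-y))
          - (expA (-x) * expA x) * x * (expA y * expA (-y))
          + (expA (-x) * expA x) * (expA y * u 1 * expA (-y))
          - (expA (-x) * expA x) * u 1 * (expA y * expA (-y))
          - (expA (-x) * expA x) * y * (expA y * expA (-y)) := by noncomm_ring
      _ = _ := by
        rw [hxx, hyy']
        noncomm_ring
  have e2 : expA (-x) * (-(c * (expA x * expA y))) * expA (-y) = -(expA (-x) * c * expA x) := by
    calc _ = -(expA (-x) * c * expA x) * (expA y * expA (-y)) := by noncomm_ring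
      _ = _ := by rw [hyy', mul_one]
  constructor
  · intro h
    have h3 : ∀ f : Ass k 2, f = expA x * (expA (-x) * f * expA (-y)) * expA y := fun f => by
      calc f = 1 * f * 1 := by noncomm_ring
        _ = expA x * expA (-x) * f * (expA (-y) * expA y) := by rw [hxx', hyy]
        _ = _ := by noncomm_ring
    rw [h3 (-(c * _)), e2, h3 (_ + _), e1, ← h]
    congr 2
    abel
  · intro h
    rw [h, e2] at e1
    rw [eq_add_of_sub_eq e1.symm]
    abel

/-! ### Solutions -/

theorem act_act_inv [CharZero k] (g : Dert k n) (f : Ass k n) : g.act (g⁻¹.act f) = f := by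
  rw [act_inv]
  exact expEnd_expEnd_neg (raises_tangential g.log) f

theorem act_inv_act [CharZero k] (g : Dert k n) (f : Ass k n) : g⁻¹.act (g.act f) = f := by
  rw [act_inv]
  exact expEnd_neg_expEnd (raises_tangential g.log) f

theorem act_add_eq_ch_iff [CharZero k] (F : Dert k 2) :
    F.act (X 0 + X 1) = ch (X 0) (X 1) ↔
      F.act (euler (F⁻¹.act (ch (X 0) (X 1)))) = ch (X 0) (X 1) := by
  have hx : X 0 ∈ Fil k 2 1 := X_mem_Fil 0
  have hy : X 1 ∈ Fil k 2 1 := X_mem_Fil 1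
  constructor
  · intro h
    rw [← h, act_inv_act, map_add, euler_X, euler_X]
  · intro h
    have h1 := congrArg F⁻¹.act h
    rw [act_inv_act] at h1
    set c : Ass k 2 := ch (X 0) (X 1)
    -- F⁻¹ is the identity modulo higher degree, so the error e starts in degree two. A series fixed
    -- by l lives in degree one, which forces e = 0.
    have h2 : F⁻¹.act c - (X 0 + X 1) ∈ Fil k 2 2 := by
      have h3 := add_mem (expEnd_sub_mem_Fil (raises_tangential (F⁻¹).log) (ch_mem_Fil hx hy))
        (ch_sub_mem_Fil_two hx hy)
      rwa [sub_add_sub_cancel] at h3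
    set e := F⁻¹.act c - (X 0 + X 1) with he
    have h3 : euler e = e := by rw [he, map_sub, h1, map_add, euler_X, euler_X]
    have h4 : e = 0 := by
      ext w
      by_cases hw : w.length < 2
      · exact h2 w hw
      · have h5 := euler_apply e w
        rw [h3] at h5
        have h6 : ((w.length : k) - 1) * e w = 0 := by rw [sub_mul, ← h5, one_mul, sub_self]
        refine (mul_eq_zero.1 h6).resolve_left ?_
        rw [← Ne, sub_ne_zero, Nat.cast_ne_one]
        omega
    rw [← sub_eq_zero.1 h4, act_act_inv]

theorem IsDer.cyc_pow_eq_zero [CharZero k] {D : Module.End k (Ass k n)} (hD : IsDer D)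
    {f : Ass k n} (hf : cyc f = 0) (d : ℕ) : cyc ((D ^ d) f) = 0 := by
  induction d with
  | zero => exact hf
  | succ d ih =>
    rw [pow_succ', Module.End.mul_apply]
    exact hD.cyc_eq_zero ih

theorem IsDer.cyc_expEnd [CharZero k] {D : Module.End k (Ass k n)} (hD : IsDer D)
    (hr : Raises 1 D) {f : Ass k n} (hf : cyc (D f) = 0) : cyc (expEnd D f) = cyc f := by
  rw [expEnd_apply, map_seriesSum raises_cyc (pow_term_mem_zero hr f fun d => (d.factorial : k)⁻¹),
    seriesSum_eq_zero_term]
  · simp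
  · intro d hd
    obtain ⟨e, rfl⟩ := Nat.exists_eq_succ_of_ne_zero hd
    rw [map_smul, pow_succ, Module.End.mul_apply, hD.cyc_pow_eq_zero hf, smul_zero]

theorem cyc_act_eq_zero [CharZero k] (g : Dert k n) {f : Ass k n} (hf : cyc f = 0) :
    cyc (g.act f) = 0 := by
  have hD := isDer_tangential g.log
  exact (hD.cyc_expEnd (raises_tangential g.log) (hD.cyc_eq_zero hf)).trans hf

theorem cyc_congr {T : Module.End k (Ass k n)} (hT : ∀ f, cyc f = 0 → cyc (T f) = 0)
    {f g : Ass k n} (h : cyc f = cyc g) : cyc (T f) = cyc (T g) := by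
  rw [← sub_eq_zero, ← map_sub, ← map_sub]
  exact hT _ (by rw [map_sub, h, sub_self])

/-- A tangential derivation acts on series in x_i as an inner derivation, hence trivially in tr_n.
-/
theorem cyc_act_subst_X [CharZero k] (g : Dert k n) (i : Fin n) (f : Ass k m) :
    cyc (g.act (subst (fun _ => X i) f)) = cyc (subst (fun _ => X i) f) := by
  have hD := isDer_tangential g.log
  refine hD.cyc_expEnd (raises_tangential g.log) ?_
  rw [hD.map_subst_of_inner (X_mem_Fil i) (tangentialDer_X _ i), cyc_ad]

/-- l multiplies cyclic words of length N by N, and `cyc` vanishes on the empty word, so nothing is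
lost at N = 0. -/
theorem cyc_euler_eq_zero_iff [CharZero k] (f : Ass k n) : cyc (euler f) = 0 ↔ cyc f = 0 := by
  refine ⟨fun h => ?_, isDer_euler.cyc_eq_zero⟩
  ext w
  have h1 : cyc (euler f) w = (w.length : k) * cyc f w := by
    rw [cyc_apply, cyc_apply, Finset.mul_sum]
    exact Finset.sum_congr rfl fun i _ => by rw [euler_apply, List.length_rotate]
  rw [h] at h1
  rcases mul_eq_zero.1 h1.symm with h2 | h2
  · have h3 : w = [] := List.length_eq_zero_iff.1 (by exact_mod_cast h2)
    rw [h3]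
    rfl
  · exact h2

/-- The series `f(y) - f(z) + f(x)`. -/
def deltaSeries (z : Ass k 2) (f : Ass k 1) : Ass k 2 :=
  subst (fun _ => X 1) f - subst (fun _ => z) f + subst (fun _ => X 0) f

theorem euler_deltaSeries (f : Ass k 1) :
    euler (deltaSeries (X 0 + X 1) f) = deltaSeries (X 0 + X 1) (euler f) := by
  have h : (X 0 + X 1 : Ass k 2) ∈ Fil k 2 1 := add_mem (X_mem_Fil 0) (X_mem_Fil 1)
  rw [deltaSeries, map_add, map_sub, euler_subst (X_mem_Fil 1) (euler_X 1),
    euler_subst (X_mem_Fil 0) (euler_X 0), euler_subst h (by rw [map_add, euler_X, euler_X])]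
  rfl

theorem cyc_act_deltaSeries [CharZero k] (g : Dert k 2) {z z' : Ass k 2} (hz : z ∈ Fil k 2 1)
    (h : g.act z = z') (f : Ass k 1) :
    cyc (g.act (deltaSeries z f)) = cyc (deltaSeries z' f) := by
  have hD := isDer_tangential g.log
  have hr := raises_tangential g.log
  have h1 : g.act (subst (fun _ => z) f) = subst (fun _ => z') f :=
    map_subst (raises_expEnd hr) hD.expEnd_one (hD.expEnd_mul hr) (fun _ => hz) (fun _ => h) f
  simp only [deltaSeries, map_add, map_sub, cyc_act_subst_X, h1]

theorem Tr_mem_range_deltaTilde_iff [CharZero k] (g : Ass k 2) :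
    Tr g ∈ LinearMap.range (deltaTilde k) ↔
      ∃ f : Ass k 1, f [] = 0 ∧ cyc g = cyc (deltaSeries (ch (X 0) (X 1)) f) := by
  have hδ : ∀ f : AssPlus k 1, deltaTilde k ((commutators k 1).mkQ f) =
      Tr (deltaSeries (ch (X 0) (X 1)) f.1) := fun _ => rfl
  constructor
  · rintro ⟨t, ht⟩
    obtain ⟨f, rfl⟩ := (commutators k 1).mkQ_surjective t
    rw [hδ, Tr_eq_iff] at ht
    exact ⟨f.1, f.2, ht.symm⟩
  · rintro ⟨f, hf, h⟩
    refine ⟨(commutators k 1).mkQ ⟨f, hf⟩, ?_⟩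
    rw [hδ, Tr_eq_iff, h]

theorem exists_euler_eq [CharZero k] {f : Ass k n} (hf : f [] = 0) :
    ∃ g : Ass k n, g [] = 0 ∧ euler g = f := by
  refine ⟨Ass.of fun w => (w.length : k)⁻¹ * f w, by simp, ?_⟩
  ext w
  rw [euler_apply, Ass.of_apply]
  by_cases hw : w = []
  · simp [hw, hf]
  · have h : (w.length : k) ≠ 0 := by
      rw [Nat.cast_ne_zero, Ne, List.length_eq_zero_iff]
      exact hw
    rw [mul_inv_cancel_left₀ h]

/-- F⁻¹ replaces ch(x,y) by x + y, where l passes through the substitutions; applying F then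
restores ch(x,y). -/
theorem cyc_conj_euler_deltaSeries [CharZero k] {F : Dert k 2}
    (hF : F.act (X 0 + X 1) = ch (X 0) (X 1)) (f : Ass k 1) :
    cyc (F.act (euler (F⁻¹.act (deltaSeries (ch (X 0) (X 1)) f)))) =
      cyc (deltaSeries (ch (X 0) (X 1)) (euler f)) := by
  have hz : (X 0 + X 1 : Ass k 2) ∈ Fil k 2 1 := add_mem (X_mem_Fil 0) (X_mem_Fil 1)
  have h1 := cyc_act_deltaSeries F⁻¹ (ch_mem_Fil (X_mem_Fil 0) (X_mem_Fil 1))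
    (z' := X 0 + X 1) (by rw [← hF, act_inv_act]) f
  rw [cyc_congr (fun _ => cyc_act_eq_zero F)
    (cyc_congr (fun _ => isDer_euler.cyc_eq_zero) h1), euler_deltaSeries,
    cyc_act_deltaSeries F hz hF]

/-- F and F⁻¹ act invertibly on tr_n, and l is injective there. -/
theorem cyc_conj_euler_injective [CharZero k] {F : Dert k n} {f g : Ass k n}
    (h : cyc (F.act (euler (F⁻¹.act f))) = cyc (F.act (euler (F⁻¹.act g)))) : cyc f = cyc g := by
  rw [← sub_eq_zero, ← map_sub] at h ⊢
  rw [← map_sub, ← map_sub, ← map_sub] at h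
  have h1 := cyc_act_eq_zero F⁻¹ h
  rw [act_inv_act, cyc_euler_eq_zero_iff] at h1
  have h2 := cyc_act_eq_zero F h1
  rwa [act_act_inv] at h2

theorem j_mem_range_iff [CharZero k] {F : Dert k 2} (hF : F.act (X 0 + X 1) = ch (X 0) (X 1))
    {u : dert k 2} (hu : tangential u = kappa F) :
    j F ∈ LinearMap.range (deltaTilde k) ↔ div u ∈ LinearMap.range (deltaTilde k) := by
  set r := expSubOneDiv (tangential F.log) (divRep F.log) with hr
  have hdiv : cyc (divRep u) = cyc (F.act (euler (F⁻¹.act r))) := by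
    rw [tangential_injective (hu.trans (tangential_kappaTuple F).symm), act_inv, hr,
      expEnd_neg_expSubOneDiv (raises_tangential F.log)]
    exact cyc_divTuple_kappaTuple (dert_mem_Fil F.log)
  rw [j, div, Tr_mem_range_deltaTilde_iff, Tr_mem_range_deltaTilde_iff, ← hr, hdiv]
  constructor
  · rintro ⟨f, hf, h⟩
    refine ⟨euler f, by rw [euler_apply, hf, mul_zero], ?_⟩
    rw [← cyc_conj_euler_deltaSeries hF]
    exact cyc_congr (fun _ => cyc_act_eq_zero F) (cyc_congr (fun _ => isDer_euler.cyc_eq_zero)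
      (cyc_congr (fun _ => cyc_act_eq_zero F⁻¹) h))
  · rintro ⟨g, hg, h⟩
    -- Dividing coefficients by word length inverts l on series without constant term; this turns a
    -- preimage of div u into one of j(F).
    obtain ⟨f, hf, rfl⟩ := exists_euler_eq hg
    rw [← cyc_conj_euler_deltaSeries hF] at h
    exact ⟨f, hf, cyc_conj_euler_injective h⟩

theorem act_add_eq_ch_iff_originalKVEquation [CharZero k] {F : Dert k 2} {u : dert k 2}
    (hu : tangential u = kappa F) :
    F.act (X 0 + X 1) = ch (X 0) (X 1) ↔ OriginalKVEquation (u.1 0) (u.1 1) := by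
  rw [originalKVEquation_iff, ← tangential_eq, hu, act_add_eq_ch_iff, kappa, sub_sub_cancel_left,
    LinearMap.neg_apply, neg_inj, Module.End.mul_apply, Module.End.mul_apply]

end

end KV

theorem mainTheorem5 (k : Type*) [Field k] [CharZero k] (F : KV.Dert k 2) :
    (∃! u : KV.dert k 2, KV.tangential u = KV.kappa F) ∧
    ∀ u : KV.dert k 2, KV.tangential u = KV.kappa F →
      (KV.IsGeneralizedKVSolution F ↔
        KV.OriginalKVEquation (u.1 0) (u.1 1) ∧
          KV.div u ∈ LinearMap.range (KV.deltaTilde k)) := by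
  refine ⟨KV.existsUnique_tangential_eq_kappa F, fun u hu => ?_⟩
  rw [KV.IsGeneralizedKVSolution, ← KV.act_add_eq_ch_iff_originalKVEquation hu]
  -- The two range conditions are compared only under F(x+y) = ch(x,y), which is needed to conjugate
  -- the differential.
  exact and_congr_right fun hF => KV.j_mem_range_iff hF hu
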